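/- **Setting.** Let $\phi:[0,\infty)\times[0,\infty)\to[0,\infty)$, $(x,t)\mapsto\phi(x,t)=\phi_x(t)$, be a $\mathcal C^1$ semiflow: $\phi(x,t+s)=\phi(\phi(x,s),t)$ for all $x,s,t\ge 0$; $\phi(\cdot,t)$ is a homeomorphism of $[0,\infty)$ onto its image for each $t\ge 0$; and $\phi_x$ is a $\mathcal C^1$-diffeomorphism of $[0,\infty)$ onto $[x,\infty)$ for each $x>0$. Let $f:[0,\infty)\to[0,\infty)$ be an increasing $\mathcal C^1$-diffeomorphism, and let $g_x=\big[(f\circ\phi_x)^{-1}\big]'$ on $[f(x),\infty)$ for $x>0$. Assume that there are $0<\kappa<1$ and continuous functions $\mathbf m,\mathbf M:(0,\infty)\to(0,\infty)$ with $\mathbf m\le\mathbf M$ such that $$0<f(x)\le\kappa x\quad(x>0),\qquad \mathbf m(y)\le g_x(y)\le\mathbf M(y)\quad(x>0,\ y\ge f(x)).$$ Let $b>0$ and let $\mathfrak c=(r,L,\mathbf a)$ be a vector of positive constants with $$r\ge f^{-1}\!\left(\left[\frac{-\ln(1-\kappa^{b+1})}{1-\kappa^{b+1}}\right]^{1/(b+1)}\right).$$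 Let $\mathcal F(\mathfrak c,b)$ be the class of continuous functions $\lambda:[0,\infty)\to[0,\infty)$ such that $$\frac{f(x)^b}{\mathbf m(f(x))}\le\frac{\lambda(x)}{\mathbf a}\quad\text{for all }x\ge r,\qquad \int_0^{f(r)}\mathbf M(u)\,\lambda(f^{-1}(u))\,du\le L,$$ where the integrand of the last integral is required to be integrable. For $\lambda\in\mathcal F(\mathfrak c,b)$ and $x_0\ge 0$, consider the piecewise deterministic Markov process with flow $\phi$, jump rate $\lambda$ and jump map $f$ started at $x_0$, and its jump chain $(Z_n)_{n\ge 0}$: $Z_0=x_0$ and $Z_{n+1}=f(\phi(Z_n,S_{n+1}))$, where, conditionally on the past, the waiting time $S_{n+1}$ satisfies $\mathbb P(S_{n+1}>t)=\exp\big(-\int_0^t\lambda(\phi(Z_n,s))\,ds\big)$ for $t\ge 0$. (The waiting time is almost surely finite, except when $x_0=0$ is a rest point of the flow and $\lambda(0)=0$, in which case we put $Z_n=0$ for all $n$.) Let $\mathcal O_a^b=\sigma(Z_j:\ a\le j\le b)$. The $\beta$-mixing coefficient of the chain is $$\beta_Z(t)=\sup_{k\ge 0}\ \sup_{E\in\mathcal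 O_0^k\otimes\mathcal O_{t+k}^\infty}\big|P_{\mathcal O_0^k\otimes\mathcal O_{t+k}^\infty}(E)-P_{\mathcal O_0^k}\otimes P_{\mathcal O_{t+k}^\infty}(E)\big|,\qquad t\in\mathbb N,$$ where $P_{\mathcal O_0^k\otimes\mathcal O_{t+k}^\infty}$ is the image of $\mathbb P$ under $\omega\mapsto(\omega,\omega)$. The chain is called geometrically $\beta$-mixing if there are $c,\beta>0$ with $\beta_Z(t)\le c\,e^{-\beta t}$ for all $t\in\mathbb N$. **Statement.** There is a constant $\gamma\in(0,1)$, which depends neither on $\lambda\in\mathcal F(\mathfrak c,b)$ nor on $x_0$, such that for each starting point $x_0\ge 0$: for each $\lambda\in\mathcal F(\mathfrak c,b)$ the jump chain $(Z_n)$ started at $x_0$ is geometrically $\beta$-mixing; and there is a constant $c>0$, which depends on $x_0$ but not on $\lambda$, such that for all $t\in\mathbb N$ $$\sup_{\lambda\in\mathcal F(\mathfrak c,b)}\beta_Z(t)\le c\,\gamma^t.$$ -/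

import Mathlib

open Set MeasureTheory ProbabilityTheory
open scoped ENNReal

noncomputable section

namespace PDMP

/-- The inverse of a function `h` on `[0,∞)` (only used on the image `h '' [0,∞)`). -/
def inv (h : ℝ → ℝ) : ℝ → ℝ := Function.invFunOn h (Ici 0)

/-- `h` is a `C¹`-diffeomorphism of `[0,∞)` onto `t` (with one-sided derivatives at end points). -/
structure IsC1Diffeo (h : ℝ → ℝ) (t : Set ℝ) : Prop where
  bijOn : BijOn h (Ici 0) t
  contDiffOn : ContDiffOn ℝ 1 h (Ici 0)
  contDiffOn_inv : ContDiffOn ℝ 1 (inv h) t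

/-- The local characteristics: a `C¹` semiflow `φ` on `[0,∞)`, given by homeomorphisms onto their
images, and a jump map `f`. Functions on `[0,∞)` are functions on `ℝ` whose values at negative
arguments are irrelevant. Each trajectory `φ_x` with `x > 0` is a `C¹`-diffeomorphism of `[0,∞)`
onto `[x,∞)`; the origin may be a rest point, as for `φ(x,t) = x e^{ct}`. -/
structure IsCharacteristics (φ : ℝ → ℝ → ℝ) (f : ℝ → ℝ) : Prop where
  flow_nonneg : ∀ x ≥ 0, ∀ t ≥ 0, 0 ≤ φ x t
  flow_contDiffOn : ContDiffOn ℝ 1 (fun p : ℝ × ℝ => φ p.1 p.2) (Ici 0 ×ˢ Ici 0)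
  flow_isEmbedding : ∀ t ≥ 0, Topology.IsEmbedding (fun x : Ici (0 : ℝ) => φ x t)
  flow_add : ∀ x ≥ 0, ∀ s ≥ 0, ∀ t ≥ 0, φ x (t + s) = φ (φ x s) t
  flow_diffeo : ∀ x > 0, IsC1Diffeo (φ x) (Ici x)
  jump_diffeo : IsC1Diffeo f (Ici 0)
  jump_strictMonoOn : StrictMonoOn f (Ici 0)

/-- `g_x(y)`, the derivative at `y` of `(f ∘ φ_x)⁻¹ : [f(x),∞) → [0,∞)`. -/
def g (φ : ℝ → ℝ → ℝ) (f : ℝ → ℝ) (x y : ℝ) : ℝ :=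
  derivWithin (inv (fun t => f (φ x t))) (Ici (f x)) y

/-- The constraints on `f` and `φ`: `0 < f(x) ≤ κ x`, and `m ≤ g_x ≤ M` on the domain `[f(x),∞)`
of `g_x`, for two positive continuous functions `m ≤ M`. -/
structure IsConstrained (φ : ℝ → ℝ → ℝ) (f m M : ℝ → ℝ) (κ : ℝ) : Prop where
  kappa_pos : 0 < κ
  kappa_lt_one : κ < 1
  jump_pos : ∀ x > 0, 0 < f x
  jump_le : ∀ x > 0, f x ≤ κ * x
  m_continuousOn : ContinuousOn m (Ioi 0)
  M_continuousOn : ContinuousOn M (Ioi 0)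
  m_pos : ∀ y > 0, 0 < m y
  m_le_M : ∀ y > 0, m y ≤ M y
  m_le_g : ∀ x > 0, ∀ y ≥ f x, m y ≤ g φ f x y
  g_le_M : ∀ x > 0, ∀ y ≥ f x, g φ f x y ≤ M y

/-- The class `𝓕(𝔠, b)` of jump rates, where `𝔠 = (r, L, a)`. -/
structure RateClass (f m M : ℝ → ℝ) (r L a b : ℝ) (lam : ℝ → ℝ) : Prop where
  continuousOn : ContinuousOn lam (Ici 0)
  nonneg : ∀ x ≥ 0, 0 ≤ lam x
  lower_bound : ∀ x ≥ r, f x ^ b / m (f x) ≤ lam x / a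
  integrableOn : IntegrableOn (fun u => M u * lam (inv f u)) (Ioc 0 (f r))
  integral_le : ∫ u in (0 : ℝ)..f r, M u * lam (inv f u) ≤ L

/-- The cumulated jump rate `Λ(x,t) = ∫₀ᵗ λ(φ(x,s)) ds`. -/
def cumRate (φ : ℝ → ℝ → ℝ) (lam : ℝ → ℝ) (x t : ℝ) : ℝ :=
  ∫ s in (0 : ℝ)..t, lam (φ x s)

/-- The waiting time before the next jump from position `x`, as a function of a standard
exponential variable `e`: the first `t ≥ 0` with `Λ(x,t) ≥ e`. Thus it exceeds `t` exactly when
`e > Λ(x,t)`, which has probability `exp(-Λ(x,t))`. -/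
def waitingTime (φ : ℝ → ℝ → ℝ) (lam : ℝ → ℝ) (x e : ℝ) : ℝ :=
  sInf {t : ℝ | 0 ≤ t ∧ e ≤ cumRate φ lam x t}

/-- The exponential distribution with parameter `1`, as a probability measure. -/
instance : IsProbabilityMeasure (expMeasure 1) := isProbabilityMeasure_expMeasure one_pos

/-- The law of a sequence of independent standard exponential variables, which drives the process. -/
def driving : Measure (ℕ → ℝ) := Measure.infinitePi (fun _ => expMeasure 1)

/-- The jump chain `Z_n = X(T_n)` started at `x₀`: from `Z_n`, the process follows the flow during
the waiting time `T_{n+1} - T_n`, then jumps by `f`. -/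
def jumpChain (φ : ℝ → ℝ → ℝ) (f lam : ℝ → ℝ) (x₀ : ℝ) : ℕ → (ℕ → ℝ) → ℝ
  | 0, _ => x₀
  | n + 1, ω =>
    f (φ (jumpChain φ f lam x₀ n ω) (waitingTime φ lam (jumpChain φ f lam x₀ n ω) (ω n)))

/-- The σ-algebra `O_a^b` generated by the `Z_j` with `a ≤ j ≤ b`. -/
@[reducible] def sigmaBetween {Ω : Type*} (Z : ℕ → Ω → ℝ) (a : ℕ) (b : ℕ∞) : MeasurableSpace Ω :=
  ⨆ j : {j : ℕ // a ≤ j ∧ (j : ℕ∞) ≤ b}, MeasurableSpace.comap (Z j) (borel ℝ)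

/-- The `β`-mixing coefficient: the supremum over `k` and over `E ∈ O_0^k ⊗ O_{t+k}^∞` of the
difference between the joint law (the image of `P` under `ω ↦ (ω, ω)`) and the product law
(`P ⊗ P`, whose restriction to `O_0^k ⊗ O_{t+k}^∞` is the product of the restrictions of `P`). -/
def betaCoeff {Ω : Type*} [MeasurableSpace Ω] (P : Measure Ω) (Z : ℕ → Ω → ℝ) (t : ℕ) : ℝ≥0∞ :=
  ⨆ (k : ℕ) (E : Set (Ω × Ω))
    (_ : MeasurableSet[(sigmaBetween Z 0 k).prod (sigmaBetween Z (t + k) ⊤)] E),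
    ENNReal.ofReal |P.real {ω | (ω, ω) ∈ E} - (P.prod P).real E|

/-- Geometric `β`-mixing: `β_Z(t) ≤ c e^{-β t}` for some constants `c` and `β > 0`. -/
def IsGeometricallyBetaMixing {Ω : Type*} [MeasurableSpace Ω] (P : Measure Ω)
    (Z : ℕ → Ω → ℝ) : Prop :=
  ∃ c > 0, ∃ β > 0, ∀ t : ℕ, betaCoeff P Z t ≤ ENNReal.ofReal (c * Real.exp (-β * t))

end PDMP

end

namespace PDMP

/-! The chain is compared with a one-dimensional random recursion whose parameters do not involve
the jump rate `lam`.

Since `g φ f x` does not depend on `x`, the substitution `y = f (φ x t)` turns the cumulated rate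
along every trajectory into an increment `C (f (φ x t)) - C (f x)` of one primitive `C`
(`exists_isHazard`). Away from a resting origin, almost surely `Z (n+1) = C⁻¹ (C (f (Z n)) + E n)`
with independent standard exponential `E n` (`IsHazard.jumpChain_eq_chain`). Above `f r`, `C` grows
at least like `θ y^(b+1)`, where `θ = a/(b+1)`. With `f x ≤ κ x` this makes `V x = θ (max x
r)^(b+1)` satisfy `V (Z (n+1)) ≤ max v₀ (ρ V (Z n) + E n)`, where `ρ = κ^(b+1)` and `v₀ = θ r^(b+1)`
(`IsHazard.isLyapunov`).

Two copies of the chain are coupled. If one of them has `V > v₀`, both receive the same noise, and a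
weight `w` of the larger `V` decreases on average. If both have `V ≤ v₀`, their hazard levels lie in
`[0, L]`, and by lack of memory they can be merged with probability at least `exp (-L)`. The weight
is chosen so that both cases give the same factor `γ < 1` (`exists_isWeight`), whence the
contraction of weighted oscillations (`IsLyapunov.contraction`).

Iterating, the law of the path after time `t` depends on the starting point by at most `γ^t w`.
Conditioning on the past at time `k` and bounding the mean of `V` uniformly in `k` gives the
`β`-mixing estimate (`IsLyapunov.betaCoeff_le`). -/

/-! ### The standard exponential distribution. -/

theorem expMeasure_one_eq :
    expMeasure 1 =
      (volume.restrict (Ioi (0 : ℝ))).withDensity (fun x => ENNReal.ofReal (Real.exp (-x))) := by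
  have h : expMeasure 1 = volume.withDensity (exponentialPDF 1) := rfl
  rw [h, restrict_Ioi_eq_restrict_Ici, ← withDensity_indicator measurableSet_Ici]
  congr 1
  ext x
  by_cases hx : 0 ≤ x
  · simp [exponentialPDF_eq, hx]
  · simp [exponentialPDF_eq, hx]

theorem integral_expMeasure_one (F : ℝ → ℝ) :
    ∫ e, F e ∂(expMeasure 1) = ∫ x in Ioi (0 : ℝ), Real.exp (-x) * F x := by
  rw [expMeasure_one_eq, integral_withDensity_eq_integral_toReal_smul (by fun_prop) (by simp)]
  simp [ENNReal.toReal_ofReal (Real.exp_nonneg _)]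

theorem integrable_expMeasure_one_iff (F : ℝ → ℝ) :
    Integrable F (expMeasure 1) ↔ IntegrableOn (fun x => Real.exp (-x) * F x) (Ioi (0 : ℝ)) := by
  rw [expMeasure_one_eq, integrable_withDensity_iff_integrable_smul' (by fun_prop) (by simp)]
  simp [ENNReal.toReal_ofReal (Real.exp_nonneg _), IntegrableOn]

theorem ae_pos_expMeasure_one : ∀ᵐ e ∂(expMeasure 1), 0 < e := by
  rw [expMeasure_one_eq]
  exact (withDensity_absolutelyContinuous _ _).ae_le (ae_restrict_mem measurableSet_Ioi)

theorem integrable_id_expMeasure_one : Integrable (fun e : ℝ => e) (expMeasure 1) := by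
  rw [integrable_expMeasure_one_iff]
  have := Real.GammaIntegral_convergent (s := 2) (by norm_num)
  refine this.congr_fun (fun x hx => ?_) measurableSet_Ioi
  norm_num

theorem integral_id_expMeasure_one : ∫ e, e ∂(expMeasure 1) = 1 := by
  rw [integral_expMeasure_one]
  have := Real.Gamma_eq_integral (s := 2) (by norm_num)
  rw [Real.Gamma_two] at this
  rw [this]
  refine setIntegral_congr_fun measurableSet_Ioi (fun x hx => ?_)
  norm_num

theorem integrable_exp_expMeasure_one {B : ℝ} (hB : 0 ≤ B) :
    Integrable (fun e => Real.exp (-(B * e))) (expMeasure 1) := by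
  rw [integrable_expMeasure_one_iff]
  refine (integrableOn_exp_mul_Ioi (a := -(1 + B)) (by linarith) 0).congr_fun
    (fun x hx => ?_) measurableSet_Ioi
  simp only
  rw [← Real.exp_add]; congr 1; ring

theorem integral_exp_expMeasure_one {B : ℝ} (hB : 0 ≤ B) :
    ∫ e, Real.exp (-(B * e)) ∂(expMeasure 1) = 1 / (1 + B) := by
  rw [integral_expMeasure_one]
  have := integral_exp_mul_Ioi (a := -(1 + B)) (by linarith) 0
  rw [mul_zero, Real.exp_zero, neg_div_neg_eq] at this
  rw [← this]
  refine setIntegral_congr_fun measurableSet_Ioi (fun x hx => ?_)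
  rw [← Real.exp_add]; congr 1; ring

/-- The memoryless property of the exponential distribution. -/
theorem integral_expMeasure_one_eq_add {F : ℝ → ℝ} (hF : Integrable F (expMeasure 1)) {d : ℝ}
    (hd : 0 ≤ d) :
    ∫ e, F e ∂(expMeasure 1) =
      ∫ e in Iic d, F e ∂(expMeasure 1) +
        Real.exp (-d) * ∫ e, F (d + e) ∂(expMeasure 1) := by
  have h1 : ∫ e in Ioi d, F e ∂(expMeasure 1) =
      Real.exp (-d) * ∫ e, F (d + e) ∂(expMeasure 1) := by
    rw [← integral_indicator measurableSet_Ioi, integral_expMeasure_one, integral_expMeasure_one,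
      ← integral_const_mul]
    have h2 : (fun x => Real.exp (-x) * (Ioi d).indicator F x) =
        (Ioi d).indicator (fun x => Real.exp (-x) * F x) := by
      ext x
      by_cases hx : x ∈ Ioi d <;> simp [hx]
    rw [h2, setIntegral_indicator measurableSet_Ioi, Ioi_inter_Ioi, max_eq_right hd]
    rw [← (measurePreserving_add_left volume d).setIntegral_preimage_emb
      (measurableEmbedding_addLeft d), preimage_const_add_Ioi, sub_self]
    refine integral_congr_ae (Filter.Eventually.of_forall fun x => ?_)
    simp only
    rw [← mul_assoc, ← Real.exp_add]; congr 2; ring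
  rw [← h1, ← compl_Iic, integral_add_compl measurableSet_Iic hF]

theorem measureReal_Iic_expMeasure_one {d : ℝ} (hd : 0 ≤ d) :
    (expMeasure 1).real (Iic d) = 1 - Real.exp (-d) := by
  have := integral_expMeasure_one_eq_add (integrable_const (1 : ℝ)) hd
  simp at this
  linarith

/-! ### Weights for the recursion `v ↦ max v₀ (ρ v + E)`. -/

/-- A weight function for the random recursion `v ↦ max v₀ (ρ v + E)`, where `E` is a standard
exponential variable: its expectation decreases geometrically outside the bottom state `v₀`, and
the expected increase at `v₀` is compensated by a coupling of probability `exp (-L)`. -/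
structure IsWeight (ρ v₀ L : ℝ) (w : ℝ → ℝ) (γ A : ℝ) : Prop where
  mono : Monotone w
  one_le : ∀ v, 1 ≤ w v
  le : ∀ v, w v ≤ A * (1 + |v|)
  drift : ∀ v > v₀, ∫ e, w (max v₀ (ρ * v + e)) ∂(expMeasure 1) ≤ γ * w v
  bottom : (1 - Real.exp (-L)) * ∫ e, w (max v₀ (ρ * v₀ + e)) ∂(expMeasure 1) ≤ γ * w v₀

theorem integrable_weight {w : ℝ → ℝ} {A : ℝ} (hw : Monotone w) (h1 : ∀ v, 1 ≤ w v)
    (hle : ∀ v, w v ≤ A * (1 + |v|)) (v₀ c : ℝ) :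
    Integrable (fun e => w (max v₀ (c + e))) (expMeasure 1) := by
  have hA : 0 ≤ A := by
    have := (h1 0).trans (hle 0); simp at this; linarith
  refine Integrable.mono' (g := fun e => A * (1 + |v₀| + |c| + |e|))
    (((integrable_const _).add integrable_id_expMeasure_one.abs).const_mul A)
    (hw.measurable.comp (by fun_prop)).aestronglyMeasurable
    (Filter.Eventually.of_forall fun e => ?_)
  rw [Real.norm_eq_abs, abs_of_nonneg (by linarith [h1 (max v₀ (c + e))])]
  refine (hle _).trans (mul_le_mul_of_nonneg_left ?_ hA)
  have h2 := abs_max_le_max_abs_abs (a := v₀) (b := c + e)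
  have h3 := abs_add_le c e
  have h4 : max |v₀| |c + e| ≤ |v₀| + |c + e| := by
    apply max_le <;> linarith [abs_nonneg v₀, abs_nonneg (c + e)]
  linarith

/-- The potential is `1 + ε v - exp (-B v)`, and `exp (-(B ρ v)) / (1 + B)` is the mean of `exp (-B
(ρ v + E))`. The linear term alone decreases on average only when `(1 - ρ) v > 1`; for smaller `v`
the exponential term, with `B` large, provides the decrease. -/
theorem exists_potential {ρ v₀ : ℝ} (hρ : 0 < ρ) (hρ1 : ρ < 1) (hv₀ : 0 < v₀) :
    ∃ B > 0, ∃ ε > 0, ∃ η > 0, ∀ v ≥ v₀,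
      1 + ε * (ρ * v + 1) - Real.exp (-(B * (ρ * v))) / (1 + B) ≤
        (1 + ε * v - Real.exp (-(B * v))) - η * (1 + ε * v) := by
  obtain ⟨B, hB, hB0⟩ : ∃ B : ℝ, 2 * (1 + B) ≤ Real.exp (B * ((1 - ρ) * v₀)) ∧ 0 < B := by
    have hk : 0 < (1 - ρ) * v₀ := mul_pos (by linarith) hv₀
    set k := (1 - ρ) * v₀
    -- With this `B`, `exp (B k) ≥ (B k)² / 2 = B (k² + 8) / 2 ≥ 4 B ≥ 2 (1 + B)`.
    refine ⟨1 + 8 / k ^ 2, ?_, by positivity⟩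
    have h1 := Real.quadratic_le_exp_of_nonneg (x := (1 + 8 / k ^ 2) * k) (by positivity)
    have h2 : ((1 + 8 / k ^ 2) * k) ^ 2 = (1 + 8 / k ^ 2) * (k ^ 2 + 8) := by field_simp
    have h3 : 0 < 8 / k ^ 2 := by positivity
    have h4 : 0 ≤ (1 + 8 / k ^ 2) * k := by positivity
    rw [h2] at h1
    nlinarith [mul_nonneg h3.le (sq_nonneg k), sq_nonneg k]
  -- Beyond `v₁` the linear term wins; `c` below is the least gain of the exponential term up to
  -- `v₁`, and the slope `ε = c / 2` is small enough not to spoil it.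
  set v₁ := 3 / (1 - ρ) with hv₁
  have hρ' : 0 < 1 - ρ := by linarith
  have hv₁0 : (1 - ρ) * v₁ = 3 := by rw [hv₁]; field_simp
  set c := Real.exp (-(B * (ρ * v₁))) / (2 * (1 + B)) with hc
  have hc0 : 0 < c := by positivity
  refine ⟨B, hB0, c / 2, by positivity, min (c / 4) ((1 - ρ) / 2), lt_min (by positivity)
    (by positivity), fun v hv => ?_⟩
  set η := min (c / 4) ((1 - ρ) / 2) with hη
  have hη1 : η ≤ c / 4 := min_le_left _ _
  have hη2 : η ≤ (1 - ρ) / 2 := min_le_right _ _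
  have hv0 : 0 < v := hv₀.trans_le hv
  have key : Real.exp (-(B * v)) ≤ Real.exp (-(B * (ρ * v))) / (2 * (1 + B)) := by
    rw [le_div_iff₀ (by positivity)]
    calc Real.exp (-(B * v)) * (2 * (1 + B))
        ≤ Real.exp (-(B * v)) * Real.exp (B * ((1 - ρ) * v)) := by
          refine mul_le_mul_of_nonneg_left (hB.trans ?_) (Real.exp_nonneg _)
          gcongr
      _ = Real.exp (-(B * (ρ * v))) := by rw [← Real.exp_add]; congr 1; ring
  have key2 : Real.exp (-(B * (ρ * v))) / (1 + B) =
      2 * (Real.exp (-(B * (ρ * v))) / (2 * (1 + B))) := by field_simp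
  have hp : 0 ≤ Real.exp (-(B * (ρ * v))) / (2 * (1 + B)) := by positivity
  have hcv : 0 < c * v := by positivity
  have e2 : η * (c * v) ≤ (1 - ρ) / 2 * (c * v) := mul_le_mul_of_nonneg_right hη2 hcv.le
  rw [key2]
  rcases le_total v v₁ with hvv | hvv
  · have : c ≤ Real.exp (-(B * (ρ * v))) / (2 * (1 + B)) := by
      rw [hc]; gcongr
    nlinarith
  · have e1 : c * 3 ≤ c * ((1 - ρ) * v) := by
      rw [← hv₁0]; gcongr
    nlinarith

/-- A small multiple `δ` of the potential is added to `1`: any `δ > 0` keeps a geometric drift above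
`v₀`, and a small one keeps the increase at `v₀` below what the merging probability `p` recovers. -/
theorem exists_isWeight {ρ v₀ L : ℝ} (hρ : 0 < ρ) (hρ1 : ρ < 1) (hv₀ : 0 < v₀) (hL : 0 < L) :
    ∃ (w : ℝ → ℝ) (γ A : ℝ), 0 < γ ∧ γ < 1 ∧ IsWeight ρ v₀ L w γ A := by
  obtain ⟨B, hB, ε, hε, η, hη, h⟩ := exists_potential hρ hρ1 hv₀
  set u : ℝ → ℝ := fun v => 1 + ε * v - Real.exp (-(B * v)) with hu
  set p := Real.exp (-L) with hp
  have hp0 : 0 < p := Real.exp_pos _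
  have hp1 : p < 1 := by rw [hp]; simpa using hL
  set C := 1 + ε * (ρ * v₀ + 1) with hC
  have hC0 : 0 < C := by positivity
  -- Chosen so that the bottom condition reads `(1 - p) (1 + p / 2) ≤ 1 - p / 2`.
  set δ := p / (2 * C) with hδ
  have hδ0 : 0 < δ := by positivity
  have hδC : δ * C = p / 2 := by rw [hδ]; field_simp
  -- The drop to `1` at and below `v₀` gives `w (max v₀ y) ≤ 1 + δ * u y` even for `0 ≤ y ≤ v₀`, so
  -- the truncation at `v₀` costs nothing in the drift estimate.
  set w : ℝ → ℝ := fun v => if v ≤ v₀ then 1 else 1 + δ * u v with hw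
  set γ := max (1 - δ * η / (1 + δ)) (1 - p / 2) with hγ
  have hγ1 : γ < 1 := max_lt (by have : 0 < δ * η / (1 + δ) := by positivity
                                 linarith) (by linarith)
  have hγ0 : 0 < γ := lt_of_lt_of_le (by linarith) (le_max_right _ _)
  have humono : Monotone u := by
    intro x y hxy
    simp only [hu]
    have h1 : ε * x ≤ ε * y := by gcongr
    have h2 : Real.exp (-(B * y)) ≤ Real.exp (-(B * x)) := by gcongr
    linarith
  have hu0 : ∀ v ≥ 0, 0 ≤ u v := by
    intro v hv
    have := humono hv
    simpa [hu] using this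
  have hwu : ∀ y ≥ 0, w (max v₀ y) ≤ 1 + δ * u y := by
    intro y hy
    simp only [hw]
    have := mul_nonneg hδ0.le (hu0 y hy)
    split_ifs with hle
    · linarith
    · rw [max_eq_right]
      by_contra hlt
      exact hle (max_le le_rfl (le_of_not_ge hlt))
  have hmono : Monotone w := by
    intro x y hxy
    simp only [hw]
    split_ifs with h1 h2 h2
    · exact le_rfl
    · have := mul_nonneg hδ0.le (hu0 y (by linarith))
      linarith
    · exact absurd (hxy.trans h2) h1
    · have := mul_le_mul_of_nonneg_left (humono hxy) hδ0.le
      linarith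
  have hone : ∀ v, 1 ≤ w v := by
    intro v
    simp only [hw]
    split_ifs with h1
    · exact le_rfl
    · have := mul_nonneg hδ0.le (hu0 v (by linarith))
      linarith
  have hwle : ∀ v, w v ≤ (1 + δ * (1 + ε)) * (1 + |v|) := by
    intro v
    have hv := abs_nonneg v
    simp only [hw]
    split_ifs with h1
    · nlinarith [mul_pos hδ0 hε, mul_nonneg (mul_pos hδ0 hε).le hv, mul_nonneg hδ0.le hv]
    · have h2 : u v ≤ (1 + ε) * (1 + |v|) := by
        simp only [hu]
        nlinarith [Real.exp_pos (-(B * v)), le_abs_self v, mul_le_mul_of_nonneg_left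
          (le_abs_self v) hε.le]
      have := mul_le_mul_of_nonneg_left h2 hδ0.le
      nlinarith
  have hint : ∀ v > 0, ∫ e, w (max v₀ (ρ * v + e)) ∂(expMeasure 1) ≤
      1 + δ * (1 + ε * (ρ * v + 1) - Real.exp (-(B * (ρ * v))) / (1 + B)) := by
    intro v hv
    have i1 : Integrable (fun e : ℝ => 1 + ε * (ρ * v + e)) (expMeasure 1) :=
      (integrable_const _).add (((integrable_const _).add integrable_id_expMeasure_one).const_mul _)
    have i2 : Integrable (fun e => Real.exp (-(B * (ρ * v))) * Real.exp (-(B * e)))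
        (expMeasure 1) := (integrable_exp_expMeasure_one hB.le).const_mul _
    have i3 : ∀ e, u (ρ * v + e) =
        (1 + ε * (ρ * v + e)) - Real.exp (-(B * (ρ * v))) * Real.exp (-(B * e)) := by
      intro e
      simp only [hu]
      rw [← Real.exp_add]
      congr 2; ring
    have i4 : Integrable (fun e => u (ρ * v + e)) (expMeasure 1) := by
      simp only [i3]; exact i1.sub i2
    calc ∫ e, w (max v₀ (ρ * v + e)) ∂(expMeasure 1)
        ≤ ∫ e, (1 + δ * u (ρ * v + e)) ∂(expMeasure 1) := by
          refine integral_mono_ae (integrable_weight hmono hone hwle _ _)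
            ((integrable_const _).add (i4.const_mul _)) ?_
          filter_upwards [ae_pos_expMeasure_one] with e he
          exact hwu _ (by positivity)
      _ = _ := by
          rw [integral_add (integrable_const _) (i4.const_mul _), integral_const_mul]
          have i5 : ∫ e, (1 + ε * (ρ * v + e)) ∂(expMeasure 1) = 1 + ε * (ρ * v + 1) := by
            have : ∀ e : ℝ, 1 + ε * (ρ * v + e) = (1 + ε * (ρ * v)) + ε * e := fun e => by ring
            simp only [this]
            rw [integral_add (integrable_const _) (integrable_id_expMeasure_one.const_mul _),
              integral_const_mul, integral_id_expMeasure_one]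
            rw [integral_const, probReal_univ]
            simp only [smul_eq_mul]
            ring
          simp only [i3]
          rw [integral_sub i1 i2, integral_const_mul, integral_exp_expMeasure_one hB.le, i5, integral_const,
            probReal_univ]
          simp only [smul_eq_mul]
          ring
  refine ⟨w, γ, 1 + δ * (1 + ε), hγ0, hγ1, hmono, hone, hwle, fun v hv => ?_, ?_⟩
  · have hv0 : 0 < v := hv₀.trans hv
    refine (hint v hv0).trans ?_
    have e1 : w v = 1 + δ * u v := by simp [hw, not_le.2 hv]
    have e2 : 1 - δ * η / (1 + δ) ≤ γ := le_max_left _ _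
    have e3 := mul_le_mul_of_nonneg_left (h v hv.le) hδ0.le
    have e4 : u v ≤ 1 + ε * v := by simp only [hu]; linarith [Real.exp_pos (-(B * v))]
    have e5 : (1 - δ * η / (1 + δ)) * w v ≤ γ * w v :=
      mul_le_mul_of_nonneg_right e2 (by linarith [hone v])
    refine le_trans ?_ e5
    rw [e1]
    have e6 : δ * η / (1 + δ) * (1 + δ * u v) ≤ δ * (η * (1 + ε * v)) := by
      rw [div_mul_eq_mul_div, div_le_iff₀ (by positivity)]
      have e7 : 1 + δ * u v ≤ (1 + ε * v) * (1 + δ) := by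
        nlinarith [mul_le_mul_of_nonneg_left e4 hδ0.le, mul_pos hε hv0]
      nlinarith [mul_le_mul_of_nonneg_left e7 (mul_pos hδ0 hη).le]
    simp only [hu] at e3 e6 ⊢
    nlinarith
  · have e1 : w v₀ = 1 := by simp [hw]
    rw [e1, mul_one]
    refine le_trans ?_ (le_max_right _ _)
    have e2 := hint v₀ hv₀
    have e3 : 0 ≤ Real.exp (-(B * (ρ * v₀))) / (1 + B) := by positivity
    have e4 : δ * (1 + ε * (ρ * v₀ + 1) - Real.exp (-(B * (ρ * v₀))) / (1 + B)) ≤ δ * C := by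
      refine mul_le_mul_of_nonneg_left ?_ hδ0.le
      linarith
    rw [hδC] at e4
    have e5 := mul_le_mul_of_nonneg_left (e2.trans (add_le_add_right e4 1)) (sub_nonneg.2 hp1.le)
    refine e5.trans ?_
    nlinarith

/-! ### One-step contraction of weighted oscillations. -/

/-- The chain `Y₀ = x`, `Y_{n+1} = q (h (Y_n) + ω_n)`. -/
def chain (h q : ℝ → ℝ) (x : ℝ) : ℕ → (ℕ → ℝ) → ℝ
  | 0, _ => x
  | n + 1, ω => q (h (chain h q x n ω) + ω n)

/-- A Lyapunov function `V` for the chain `x ↦ q (h x + E)`, where `E ≥ 0`. -/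
structure IsLyapunov (h q V : ℝ → ℝ) (ρ v₀ L : ℝ) : Prop where
  measurable_h : Measurable h
  measurable_q : Measurable q
  measurable_V : Measurable V
  le_V : ∀ x, v₀ ≤ V x
  V_step_le : ∀ x, ∀ e ≥ 0, V (q (h x + e)) ≤ max v₀ (ρ * V x + e)
  h_mem : ∀ x, V x ≤ v₀ → h x ∈ Icc 0 L
  mono : Monotone fun c => V (q c)

variable {h q V : ℝ → ℝ} {ρ v₀ L : ℝ}

theorem integrable_comp_of_abs_le {G : ℝ → ℝ} {A : ℝ} (hG : Measurable G)
    (hA : ∀ x, |G x| ≤ A) {u : ℝ → ℝ} (hu : Measurable u) :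
    Integrable (fun e => G (u e)) (expMeasure 1) :=
  Integrable.of_bound (hG.comp hu).aestronglyMeasurable A
    (Filter.Eventually.of_forall fun _ => hA _)

theorem integral_mem_Icc_of_mem_Icc {Ω : Type*} [MeasurableSpace Ω] {P : Measure Ω}
    [IsProbabilityMeasure P] {f : Ω → ℝ} (hf : Measurable f) (hf01 : ∀ ω, f ω ∈ Icc (0 : ℝ) 1) :
    ∫ ω, f ω ∂P ∈ Icc (0 : ℝ) 1 := by
  refine ⟨integral_nonneg fun ω => (hf01 _).1, ?_⟩
  have := integral_mono (μ := P) (Integrable.of_mem_Icc 0 1 hf.aemeasurable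
    (Filter.Eventually.of_forall hf01)) (integrable_const 1) fun ω => (hf01 ω).2
  simpa using this

/-- By lack of memory, the chain from `x`, given that its noise exceeds `d = h y - h x`, has the law
of the chain from `y`. These parts cancel; an event of probability `1 - exp (-d) ≤ 1 - exp (-L)`
remains, on which the bottom condition on the weight applies. -/
theorem IsLyapunov.contraction_of_le (hV : IsLyapunov h q V ρ v₀ L) (hv₀ : 0 ≤ v₀) (hρ : 0 ≤ ρ)
    (hρ1 : ρ ≤ 1) {w : ℝ → ℝ} {γ A : ℝ} (hw : IsWeight ρ v₀ L w γ A) {G : ℝ → ℝ} {a C : ℝ}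
    (hG : Measurable G) (ha : ∀ x, |G x| ≤ a) (hC : 0 ≤ C)
    (hosc : ∀ x y, |G x - G y| ≤ C * w (max (V x) (V y))) {x y : ℝ} (hx : V x ≤ v₀)
    (hy : V y ≤ v₀) (hxy : h x ≤ h y) :
    |∫ e, G (q (h x + e)) ∂(expMeasure 1) - ∫ e, G (q (h y + e)) ∂(expMeasure 1)| ≤
      γ * C * w v₀ := by
  have hqx : ∀ z, Measurable fun e => q (h z + e) := fun z =>
    hV.measurable_q.comp (measurable_const_add _)
  have ix : ∀ z, Integrable (fun e => G (q (h z + e))) (expMeasure 1) := fun z =>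
    integrable_comp_of_abs_le hG ha (hqx z)
  have hd : 0 ≤ h y - h x := sub_nonneg.2 hxy
  have hVy : V (q (h y)) ≤ v₀ := by
    have := hV.V_step_le y 0 le_rfl
    rw [add_zero, add_zero] at this
    refine this.trans (max_le le_rfl ?_)
    nlinarith [hV.le_V y]
  set K := ∫ e, G (q (h y + e)) ∂(expMeasure 1) with hK
  set W := ∫ e, w (max v₀ (ρ * v₀ + e)) ∂(expMeasure 1) with hW
  have hW0 : 0 ≤ W := integral_nonneg fun e => zero_le_one.trans (hw.one_le _)
  have e1 : ∫ e, G (q (h x + e)) ∂(expMeasure 1) - K =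
      ∫ e in Iic (h y - h x), (G (q (h x + e)) - K) ∂(expMeasure 1) := by
    rw [integral_expMeasure_one_eq_add (ix x) hd, integral_sub (ix x).integrableOn
      (integrable_const _), setIntegral_const, measureReal_Iic_expMeasure_one hd]
    have : ∀ e, h x + (h y - h x + e) = h y + e := fun e => by ring
    simp only [this, smul_eq_mul, ← hK]
    ring
  -- Noise at most `h y - h x` leaves the chain from `x` at or below `q (h y)` in the order of `V`,
  -- hence in the bottom region. Only the other copy, with an independent noise `e'`, can leave it.
  have e2 : ∀ e ∈ Iic (h y - h x), ‖G (q (h x + e)) - K‖ ≤ C * W := by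
    intro e he
    have h3 : V (q (h x + e)) ≤ v₀ := by
      refine le_trans (hV.mono ?_) hVy
      have := mem_Iic.1 he
      linarith
    have h4 : G (q (h x + e)) - K =
        ∫ e', (G (q (h x + e)) - G (q (h y + e'))) ∂(expMeasure 1) := by
      rw [integral_sub (integrable_const _) (ix y), integral_const, probReal_univ, one_smul]
    rw [h4, hW, ← integral_const_mul]
    refine (norm_integral_le_integral_norm _).trans (integral_mono_ae
      ((integrable_const _).sub (ix y)).norm
      ((integrable_weight hw.mono hw.one_le hw.le _ _).const_mul C) ?_)
    filter_upwards [ae_pos_expMeasure_one] with e' he'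
    refine (hosc _ _).trans (mul_le_mul_of_nonneg_left (hw.mono ?_) hC)
    refine max_le (h3.trans (le_max_left _ _)) ((hV.V_step_le y e' he'.le).trans ?_)
    gcongr
  rw [e1, ← Real.norm_eq_abs]
  refine (norm_setIntegral_le_of_norm_le_const (measure_lt_top _ _) e2).trans ?_
  rw [measureReal_Iic_expMeasure_one hd]
  have e3 : Real.exp (-L) ≤ Real.exp (-(h y - h x)) := by
    gcongr
    linarith [(hV.h_mem x hx).1, (hV.h_mem y hy).2]
  calc C * W * (1 - Real.exp (-(h y - h x))) ≤ C * W * (1 - Real.exp (-L)) := by gcongr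
    _ = C * ((1 - Real.exp (-L)) * W) := by ring
    _ ≤ C * (γ * w v₀) := mul_le_mul_of_nonneg_left hw.bottom hC
    _ = _ := by ring

/-- Outside the bottom region both copies use the same noise: `max (V x) (V y)` is then dominated by
the scalar recursion, to which the drift of the weight applies. -/
theorem IsLyapunov.contraction (hV : IsLyapunov h q V ρ v₀ L) (hv₀ : 0 ≤ v₀) (hρ : 0 ≤ ρ)
    (hρ1 : ρ ≤ 1) {w : ℝ → ℝ} {γ A : ℝ} (hw : IsWeight ρ v₀ L w γ A) {G : ℝ → ℝ} {a C : ℝ}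
    (hG : Measurable G) (ha : ∀ x, |G x| ≤ a) (hC : 0 ≤ C)
    (hosc : ∀ x y, |G x - G y| ≤ C * w (max (V x) (V y))) (x y : ℝ) :
    |∫ e, G (q (h x + e)) ∂(expMeasure 1) - ∫ e, G (q (h y + e)) ∂(expMeasure 1)| ≤
      γ * C * w (max (V x) (V y)) := by
  rcases le_or_gt (max (V x) (V y)) v₀ with hle | hlt
  · obtain ⟨hx, hy⟩ := max_le_iff.1 hle
    have : max (V x) (V y) = v₀ := le_antisymm hle ((hV.le_V x).trans (le_max_left _ _))
    rw [this]
    rcases le_total (h x) (h y) with hxy | hxy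
    · exact hV.contraction_of_le hv₀ hρ hρ1 hw hG ha hC hosc hx hy hxy
    · rw [abs_sub_comm]
      exact hV.contraction_of_le hv₀ hρ hρ1 hw hG ha hC hosc hy hx hxy
  · have ix : ∀ z, Integrable (fun e => G (q (h z + e))) (expMeasure 1) := fun z =>
      integrable_comp_of_abs_le hG ha (hV.measurable_q.comp (measurable_const_add _))
    rw [← integral_sub (ix x) (ix y), ← Real.norm_eq_abs]
    calc ‖∫ e, (G (q (h x + e)) - G (q (h y + e))) ∂(expMeasure 1)‖
        ≤ ∫ e, C * w (max v₀ (ρ * max (V x) (V y) + e)) ∂(expMeasure 1) := by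
          refine (norm_integral_le_integral_norm _).trans (integral_mono_ae
            ((ix x).sub (ix y)).norm
            ((integrable_weight hw.mono hw.one_le hw.le _ _).const_mul C) ?_)
          filter_upwards [ae_pos_expMeasure_one] with e he
          refine (hosc _ _).trans (mul_le_mul_of_nonneg_left (hw.mono ?_) hC)
          refine max_le ((hV.V_step_le x e he.le).trans ?_) ((hV.V_step_le y e he.le).trans ?_)
          · gcongr; exact le_max_left _ _
          · gcongr; exact le_max_right _ _
      _ = C * ∫ e, w (max v₀ (ρ * max (V x) (V y) + e)) ∂(expMeasure 1) :=
          integral_const_mul _ _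
      _ ≤ C * (γ * w (max (V x) (V y))) := mul_le_mul_of_nonneg_left (hw.drift _ hlt) hC
      _ = _ := by ring

/-! ### Markov property by splicing noise sequences, and path estimates. -/

instance : IsProbabilityMeasure driving := by unfold driving; infer_instance

/-- The sequence which follows `p.1` before time `n` and then `p.2`. -/
def splice (n : ℕ) (p : (ℕ → ℝ) × (ℕ → ℝ)) : ℕ → ℝ :=
  fun i => if i < n then p.1 i else p.2 (i - n)

theorem measurable_splice (n : ℕ) : Measurable (splice n) := by
  refine measurable_pi_lambda _ fun i => ?_
  unfold splice
  split_ifs <;> fun_prop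

/-- This carries the Markov property: replacing the noise from time `n` on by an independent copy
does not change the law, so the chain restarts from its position at time `n` with fresh noise. -/
theorem measurePreserving_splice (n : ℕ) :
    MeasurePreserving (splice n) (driving.prod driving) driving := by
  refine ⟨measurable_splice n, ?_⟩
  refine Measure.eq_infinitePi _ fun s t ht => ?_
  have hs : MeasurableSet ((s : Set ℕ).pi t) := MeasurableSet.pi s.countable_toSet fun i _ => ht i
  rw [Measure.map_apply (measurable_splice n) hs]
  set s₁ := s.filter (· < n) with hs₁
  set s₂ := (s.filter (fun i => ¬ i < n)).image (· - n) with hs₂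
  have hinj : Set.InjOn (fun i => i - n) (s.filter (fun i => ¬ i < n) : Set ℕ) := by
    intro i hi j hj hij
    simp at hi hj hij
    omega
  have : splice n ⁻¹' (s : Set ℕ).pi t =
      ((s₁ : Set ℕ).pi t) ×ˢ ((s₂ : Set ℕ).pi fun i => t (i + n)) := by
    ext ⟨ω, ω'⟩
    simp only [mem_preimage, Set.mem_pi, mem_prod, Finset.mem_coe, hs₁, hs₂, splice,
      Finset.mem_filter, Finset.mem_image]
    constructor
    · refine fun H => ⟨fun i hi => by simpa [hi.2] using H i hi.1, ?_⟩
      rintro _ ⟨i, ⟨hi, hin⟩, rfl⟩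
      have := H i hi
      rw [if_neg hin] at this
      rwa [Nat.sub_add_cancel (not_lt.1 hin)]
    · rintro ⟨H1, H2⟩ i hi
      split_ifs with hin
      · exact H1 i ⟨hi, hin⟩
      · have := H2 (i - n) ⟨i, ⟨hi, hin⟩, rfl⟩
        rwa [Nat.sub_add_cancel (not_lt.1 hin)] at this
  rw [this, Measure.prod_prod]
  unfold driving
  rw [Measure.infinitePi_pi _ fun i _ => ht i, Measure.infinitePi_pi _ fun i _ => ht (i + n), hs₂,
    Finset.prod_image hinj, ← Finset.prod_filter_mul_prod_filter_not s (· < n)]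
  congr 1
  refine Finset.prod_congr rfl fun i hi => ?_
  rw [Nat.sub_add_cancel (not_lt.1 (Finset.mem_filter.1 hi).2)]

theorem integral_driving_eq_splice (n : ℕ) {f : (ℕ → ℝ) → ℝ} (hf : Measurable f)
    (hf01 : ∀ ω, f ω ∈ Icc (0 : ℝ) 1) :
    ∫ ω, f ω ∂driving = ∫ ω, ∫ ω', f (splice n (ω, ω')) ∂driving ∂driving := by
  rw [← integral_prod (fun p => f (splice n p)), ← integral_map (measurable_splice n).aemeasurable
    hf.aestronglyMeasurable, (measurePreserving_splice n).map_eq]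
  refine Integrable.of_mem_Icc 0 1 (hf.comp (measurable_splice n)).aemeasurable
    (Filter.Eventually.of_forall fun p => hf01 _)

theorem measurePreserving_eval_driving (n : ℕ) :
    MeasurePreserving (fun ω : ℕ → ℝ => ω n) driving (expMeasure 1) :=
  measurePreserving_eval_infinitePi _ n

theorem ae_pos_driving : ∀ᵐ ω ∂driving, ∀ n : ℕ, 0 < ω n :=
  ae_all_iff.2 fun n => (measurePreserving_eval_driving n).quasiMeasurePreserving.ae
    ae_pos_expMeasure_one

theorem measurable_chain (hh : Measurable h) (hq : Measurable q) (n : ℕ) :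
    Measurable fun p : ℝ × (ℕ → ℝ) => chain h q p.1 n p.2 := by
  induction n with
  | zero => exact measurable_fst
  | succ n ih =>
    exact hq.comp ((hh.comp ih).add ((measurable_pi_apply n).comp measurable_snd))

theorem chain_splice_of_le (x : ℝ) (n : ℕ) (p : (ℕ → ℝ) × (ℕ → ℝ)) {j : ℕ} (hj : j ≤ n) :
    chain h q x j (splice n p) = chain h q x j p.1 := by
  induction j with
  | zero => rfl
  | succ j ih => simp [chain, ih (by omega), splice, show j < n by omega]

theorem chain_splice_add (x : ℝ) (n : ℕ) (p : (ℕ → ℝ) × (ℕ → ℝ)) (j : ℕ) :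
    chain h q x (n + j) (splice n p) = chain h q (chain h q x n p.1) j p.2 := by
  induction j with
  | zero => exact chain_splice_of_le x n p le_rfl
  | succ j ih => rw [← add_assoc]; simp [chain, ih, splice]

/-- `Γ` is a functional of the whole path after time `t`, since the mixing coefficient involves the
whole future. Induction on `t`: the first step is split off by splicing, and `contraction` applies
to the expectation as a function of the position reached. -/
theorem IsLyapunov.abs_integral_path_sub_le (hV : IsLyapunov h q V ρ v₀ L) (hv₀ : 0 ≤ v₀)
    (hρ : 0 ≤ ρ) (hρ1 : ρ ≤ 1) {w : ℝ → ℝ} {γ A : ℝ} (hw : IsWeight ρ v₀ L w γ A) (hγ : 0 ≤ γ)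
    {Γ : (ℕ → ℝ) → ℝ} (hΓ : Measurable Γ) (hΓ01 : ∀ y, Γ y ∈ Icc (0 : ℝ) 1) (t : ℕ) (x y : ℝ) :
    |∫ ω, Γ (fun j => chain h q x (t + j) ω) ∂driving -
      ∫ ω, Γ (fun j => chain h q y (t + j) ω) ∂driving| ≤ γ ^ t * w (max (V x) (V y)) := by
  have hm : ∀ t, Measurable fun p : ℝ × (ℕ → ℝ) => Γ (fun j => chain h q p.1 (t + j) p.2) :=
    fun t => hΓ.comp (measurable_pi_lambda _ fun j =>
      measurable_chain hV.measurable_h hV.measurable_q _)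
  have h01 : ∀ t x, ∫ ω, Γ (fun j => chain h q x (t + j) ω) ∂driving ∈ Icc (0 : ℝ) 1 := by
    intro t x
    exact integral_mem_Icc_of_mem_Icc ((hm t).comp measurable_prodMk_left) fun ω => hΓ01 _
  induction t generalizing x y with
  | zero =>
    have h1 := h01 0 x
    have h2 := h01 0 y
    rw [pow_zero, one_mul]
    refine le_trans ?_ (hw.one_le _)
    rw [abs_le]
    constructor <;> linarith [h1.1, h1.2, h2.1, h2.2]
  | succ t ih =>
    set G : ℝ → ℝ := fun x => ∫ ω, Γ (fun j => chain h q x (t + j) ω) ∂driving with hG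
    have hGm : Measurable G := (hm t).stronglyMeasurable.integral_prod_right.measurable
    have step : ∀ x, ∫ ω, Γ (fun j => chain h q x (t + 1 + j) ω) ∂driving =
        ∫ e, G (q (h x + e)) ∂(expMeasure 1) := by
      intro x
      have hmx : Measurable fun ω => Γ (fun j => chain h q x (t + 1 + j) ω) :=
        (hm (t + 1)).comp measurable_prodMk_left
      rw [integral_driving_eq_splice 1 hmx fun ω => hΓ01 _]
      have : ∀ ω ω' : ℕ → ℝ, (fun j => chain h q x (t + 1 + j) (splice 1 (ω, ω'))) =
          fun j => chain h q (q (h x + ω 0)) (t + j) ω' := by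
        intro ω ω'
        ext j
        rw [show t + 1 + j = 1 + (t + j) by ring, chain_splice_add]
        rfl
      simp only [this]
      rw [← (measurePreserving_eval_driving 0).map_eq,
        integral_map (measurable_pi_apply 0).aemeasurable]
      exact (hGm.comp (hV.measurable_q.comp (measurable_const_add _))).aestronglyMeasurable
    rw [step, step, pow_succ']
    refine hV.contraction hv₀ hρ hρ1 hw hGm (a := 1) (fun x => ?_) (pow_nonneg hγ t) ih x y
    rw [abs_of_nonneg (h01 t x).1]
    exact (h01 t x).2

/-- The means obey `u (n+1) ≤ ρ u n + v₀ + 1`, whose fixed point is `(v₀ + 1) / (1 - ρ)`. Uniformity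
in `n` is what the supremum over `k` in the mixing coefficient requires. -/
theorem IsLyapunov.integrable_and_integral_le (hV : IsLyapunov h q V ρ v₀ L) (hv₀ : 0 ≤ v₀)
    (hρ : 0 ≤ ρ) (hρ1 : ρ < 1) (x : ℝ) (n : ℕ) :
    Integrable (fun ω => V (chain h q x n ω)) driving ∧
      ∫ ω, V (chain h q x n ω) ∂driving ≤ V x + (v₀ + 1) / (1 - ρ) := by
  have hVx : 0 ≤ V x := hv₀.trans (hV.le_V x)
  have hρ' : 0 < 1 - ρ := by linarith
  have hD : 0 ≤ (v₀ + 1) / (1 - ρ) := by positivity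
  induction n with
  | zero =>
    simp only [chain]
    refine ⟨integrable_const _, ?_⟩
    simp
    exact hD
  | succ n ih =>
    have ie : Integrable (fun ω : ℕ → ℝ => ω n) driving :=
      (measurePreserving_eval_driving n).integrable_comp_of_integrable integrable_id_expMeasure_one
    have ie1 : ∫ ω : ℕ → ℝ, ω n ∂driving = 1 := by
      rw [← integral_id_expMeasure_one, ← (measurePreserving_eval_driving n).map_eq,
        integral_map (measurable_pi_apply n).aemeasurable (by fun_prop)]
    have hb : ∀ᵐ ω ∂driving, V (chain h q x (n + 1) ω) ≤
        v₀ + (ρ * V (chain h q x n ω) + ω n) := by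
      filter_upwards [ae_pos_driving] with ω hω
      refine (hV.V_step_le _ _ (hω n).le).trans (max_le ?_ ?_)
      · have := mul_nonneg hρ (hv₀.trans (hV.le_V (chain h q x n ω)))
        linarith [hω n]
      · linarith
    have i2 : Integrable (fun ω => v₀ + (ρ * V (chain h q x n ω) + ω n)) driving :=
      (integrable_const _).add ((ih.1.const_mul ρ).add ie)
    have i1 : Integrable (fun ω => V (chain h q x (n + 1) ω)) driving := by
      refine i2.mono' (hV.measurable_V.comp ((measurable_chain hV.measurable_h hV.measurable_q
        (n + 1)).comp measurable_prodMk_left)).aestronglyMeasurable ?_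
      filter_upwards [hb] with ω hω
      rwa [Real.norm_eq_abs, abs_of_nonneg (hv₀.trans (hV.le_V _))]
    refine ⟨i1, (integral_mono_ae i1 i2 hb).trans ?_⟩
    have i3 : Integrable (fun ω => ρ * V (chain h q x n ω) + ω n) driving :=
      (ih.1.const_mul ρ).add ie
    rw [integral_add (integrable_const _) i3,
      integral_add (ih.1.const_mul ρ) ie, integral_const_mul, ie1, integral_const, probReal_univ,
      one_smul]
    have h1 := mul_le_mul_of_nonneg_left ih.2 hρ
    have h2 : (v₀ + 1) / (1 - ρ) * (1 - ρ) = v₀ + 1 := div_mul_cancel₀ _ hρ'.ne'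
    nlinarith

/-! ### From path estimates to `β`-mixing. -/

/-- The times between `a` and `b`. -/
abbrev TimeWindow (a : ℕ) (b : ℕ∞) : Type := {j : ℕ // a ≤ j ∧ (j : ℕ∞) ≤ b}

theorem sigmaBetween_eq_comap {Ω : Type*} (Z : ℕ → Ω → ℝ) (a : ℕ) (b : ℕ∞) :
    sigmaBetween Z a b =
      MeasurableSpace.comap (fun ω (j : TimeWindow a b) => Z j ω)
        MeasurableSpace.pi := by
  unfold sigmaBetween MeasurableSpace.pi
  rw [MeasurableSpace.comap_iSup]
  refine iSup_congr fun j => ?_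
  rw [MeasurableSpace.comap_comp]
  rfl

theorem measureReal_preimage_eq_integral {Ω α : Type*} [MeasurableSpace Ω] [MeasurableSpace α]
    {P : Measure Ω} {X Y : Ω → α} (hXY : X =ᵐ[P] Y) (hY : Measurable Y) {S : Set α}
    (hS : MeasurableSet S) :
    P.real (X ⁻¹' S) = ∫ ω, S.indicator (fun _ => (1 : ℝ)) (Y ω) ∂P := by
  have h1 : P.real (X ⁻¹' S) = P.real (Y ⁻¹' S) := by
    refine measureReal_congr ?_
    filter_upwards [hXY] with ω hω
    change (X ω ∈ S) = (Y ω ∈ S)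
    rw [hω]
  rw [h1]
  have h2 : (fun ω => S.indicator (fun _ => (1 : ℝ)) (Y ω)) =
      (Y ⁻¹' S).indicator fun _ => (1 : ℝ) := rfl
  rw [h2, integral_indicator_const _ (hY hS)]
  simp

/-- Conditionally on the past, the future depends only on the position at time `k`. The joint and
product probabilities thus average the same function `T`, at the true position and at an independent
copy of it; `T` varies by at most `γ^t * A * (1 + V z + V z')`. -/
theorem IsLyapunov.betaCoeff_le (hV : IsLyapunov h q V ρ v₀ L) (hv₀ : 0 ≤ v₀) (hρ : 0 ≤ ρ)
    (hρ1 : ρ < 1) {w : ℝ → ℝ} {γ A : ℝ} (hw : IsWeight ρ v₀ L w γ A) (hγ : 0 ≤ γ) (x : ℝ)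
    {Z : ℕ → (ℕ → ℝ) → ℝ} (hZ : ∀ᵐ ω ∂driving, ∀ n, Z n ω = chain h q x n ω) (t : ℕ) :
    betaCoeff driving Z t ≤
      ENNReal.ofReal (A * (1 + 2 * (V x + (v₀ + 1) / (1 - ρ))) * γ ^ t) := by
  refine iSup_le fun k => iSup_le fun E => iSup_le fun hE => ENNReal.ofReal_le_ofReal ?_
  have hA : 0 ≤ A := by
    have := (hw.one_le 0).trans (hw.le 0)
    simp at this
    linarith
  have hγt : 0 ≤ γ ^ t := pow_nonneg hγ t
  rw [sigmaBetween_eq_comap, sigmaBetween_eq_comap] at hE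
  rw [← MeasurableSpace.comap_prodMap] at hE
  obtain ⟨S, hS, rfl⟩ := hE
  set past : (ℕ → ℝ) → TimeWindow 0 k → ℝ :=
    fun ω j => chain h q x j ω with hpast
  set fut : (ℕ → ℝ) → TimeWindow (t + k) ⊤ → ℝ :=
    fun ω j => chain h q x j ω with hfut
  have hchain : ∀ x n, Measurable (chain h q x n) := fun x n =>
    (measurable_chain hV.measurable_h hV.measurable_q n).comp measurable_prodMk_left
  have hpastm : Measurable past := measurable_pi_lambda _ fun j => hchain x j
  have hfutm : Measurable fut := measurable_pi_lambda _ fun j => hchain x j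
  set Φ := S.indicator fun _ => (1 : ℝ) with hΦ
  have hΦm : Measurable Φ := measurable_const.indicator hS
  have hΦ01 : ∀ p, Φ p ∈ Icc (0 : ℝ) 1 := by
    intro p
    by_cases hp : p ∈ S <;> simp [hΦ, hp]
  have hjoint : driving.real {ω | (ω, ω) ∈ Prod.map (fun ω (j : TimeWindow 0 k) => Z j ω)
        (fun ω (j : TimeWindow (t + k) ⊤) => Z j ω) ⁻¹' S} =
      ∫ ω, Φ (past ω, fut ω) ∂driving := by
    refine measureReal_preimage_eq_integral
      (X := fun ω => ((fun j : TimeWindow 0 k => Z j ω), (fun j : TimeWindow (t + k) ⊤ => Z j ω))) ?_ (hpastm.prodMk hfutm) hS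
    filter_upwards [hZ] with ω hω
    simp [hpast, hfut, hω]
  have hprod : (driving.prod driving).real
      (Prod.map (fun ω (j : TimeWindow 0 k) => Z j ω)
        (fun ω (j : TimeWindow (t + k) ⊤) => Z j ω) ⁻¹' S) =
      ∫ ω, ∫ ω', Φ (past ω, fut ω') ∂driving ∂driving := by
    rw [← integral_prod (fun p : (ℕ → ℝ) × (ℕ → ℝ) => Φ (past p.1, fut p.2))]
    · refine measureReal_preimage_eq_integral (Y := fun p : (ℕ → ℝ) × (ℕ → ℝ) => (past p.1, fut p.2)) ?_
        (hpastm.prodMap hfutm) hS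
      filter_upwards [Measure.quasiMeasurePreserving_fst.ae hZ,
        Measure.quasiMeasurePreserving_snd.ae hZ] with p hp1 hp2
      simp [hpast, hfut, hp1, hp2, Prod.map]
    · exact Integrable.of_mem_Icc 0 1 (hΦm.comp (hpastm.prodMap hfutm)).aemeasurable
        (Filter.Eventually.of_forall fun p => hΦ01 _)
  -- The probability of the event given the past `p` and the position `z` at time `k`. Future times
  -- are at least `t + k`, so after the restart they are at least `t`.
  set T : (TimeWindow 0 k → ℝ) → ℝ → ℝ := fun p z =>
    ∫ ω', Φ (p, fun j => chain h q z (t + (j - (t + k))) ω') ∂driving with hT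
  have hTm : Measurable fun r : (TimeWindow 0 k → ℝ) × ℝ => T r.1 r.2 := by
    have : Measurable fun r : ((TimeWindow 0 k → ℝ) × ℝ) × (ℕ → ℝ) =>
        Φ (r.1.1, fun j : TimeWindow (t + k) ⊤ =>
          chain h q r.1.2 (t + (j - (t + k))) r.2) := by
      refine hΦm.comp (Measurable.prodMk (by fun_prop) (measurable_pi_lambda _ fun j => ?_))
      exact (measurable_chain hV.measurable_h hV.measurable_q _).comp
        ((measurable_snd.comp measurable_fst).prodMk measurable_snd)
    exact this.stronglyMeasurable.integral_prod_right.measurable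
  have hT01 : ∀ p z, T p z ∈ Icc (0 : ℝ) 1 := fun p z =>
    integral_mem_Icc_of_mem_Icc (hΦm.comp (measurable_const.prodMk
      (measurable_pi_lambda _ fun j => hchain z _))) fun ω => hΦ01 _
  have hTd : ∀ p z z', |T p z - T p z'| ≤ γ ^ t * (A * (1 + V z + V z')) := by
    intro p z z'
    have h1 := hV.abs_integral_path_sub_le hv₀ hρ hρ1.le hw hγ
      (Γ := fun y => Φ (p, fun j => y (j - (t + k))))
      (hΦm.comp (measurable_const.prodMk (measurable_pi_lambda _ fun j => measurable_pi_apply _)))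
      (fun y => hΦ01 _) t z z'
    refine h1.trans (mul_le_mul_of_nonneg_left ((hw.le _).trans
      (mul_le_mul_of_nonneg_left ?_ hA)) hγt)
    have h2 := hv₀.trans (hV.le_V z)
    have h3 := hv₀.trans (hV.le_V z')
    rw [abs_of_nonneg (h2.trans (le_max_left _ _))]
    have := max_le (c := V z + V z') (a := V z) (b := V z') (by linarith) (by linarith)
    linarith
  have hfuts : ∀ ω ω', fut (splice k (ω, ω')) =
      fun j : TimeWindow (t + k) ⊤ => chain h q (chain h q x k ω) (t + (j - (t + k))) ω' := by
    intro ω ω'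
    ext j
    have hj := j.2.1
    simp only [hfut]
    rw [← chain_splice_add x k (ω, ω')]
    congr 1
    omega
  have hpasts : ∀ ω ω', past (splice k (ω, ω')) = past ω := by
    intro ω ω'
    ext j
    exact chain_splice_of_le x k (ω, ω') (by exact_mod_cast j.2.2)
  have hj2 : ∫ ω, Φ (past ω, fut ω) ∂driving = ∫ ω, T (past ω) (chain h q x k ω) ∂driving := by
    rw [integral_driving_eq_splice k (f := fun ω => Φ (past ω, fut ω))
      (hΦm.comp (hpastm.prodMk hfutm)) fun ω => hΦ01 _]
    simp only [hfuts, hpasts, hT]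
  have hp2 : ∀ p, ∫ ω', Φ (p, fut ω') ∂driving = ∫ ω', T p (chain h q x k ω') ∂driving := by
    intro p
    rw [integral_driving_eq_splice k (f := fun ω => Φ (p, fut ω))
      (hΦm.comp (measurable_const.prodMk hfutm)) fun ω => hΦ01 _]
    simp only [hfuts, hT]
  have hTi : ∀ p, Integrable (fun ω => T p (chain h q x k ω)) driving := fun p =>
    Integrable.of_mem_Icc 0 1 (hTm.comp (measurable_const.prodMk (hchain x k))).aemeasurable
      (Filter.Eventually.of_forall fun ω => hT01 _ _)
  have hTj : Integrable (fun ω => T (past ω) (chain h q x k ω)) driving :=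
    Integrable.of_mem_Icc 0 1 (hTm.comp (hpastm.prodMk (hchain x k))).aemeasurable
      (Filter.Eventually.of_forall fun ω => hT01 _ _)
  have hTp : Integrable (fun ω => ∫ ω', T (past ω) (chain h q x k ω') ∂driving) driving := by
    have : Measurable fun r : (ℕ → ℝ) × (ℕ → ℝ) => T (past r.1) (chain h q x k r.2) :=
      hTm.comp (hpastm.prodMap (hchain x k))
    refine Integrable.of_mem_Icc 0 1
      this.stronglyMeasurable.integral_prod_right.measurable.aemeasurable
      (Filter.Eventually.of_forall fun ω => integral_mem_Icc_of_mem_Icc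
        (this.comp measurable_prodMk_left) fun ω' => hT01 _ _)
  obtain ⟨iV, hVle⟩ := hV.integrable_and_integral_le hv₀ hρ hρ1 x k
  set m := ∫ ω, V (chain h q x k ω) ∂driving with hm
  rw [hjoint, hprod, hj2]
  simp only [hp2]
  have hinner : ∀ ω, |T (past ω) (chain h q x k ω) -
      ∫ ω', T (past ω) (chain h q x k ω') ∂driving| ≤
      γ ^ t * (A * (1 + V (chain h q x k ω) + m)) := by
    intro ω
    have h1 : T (past ω) (chain h q x k ω) - ∫ ω', T (past ω) (chain h q x k ω') ∂driving =
        ∫ ω', (T (past ω) (chain h q x k ω) - T (past ω) (chain h q x k ω')) ∂driving := by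
      rw [integral_sub (integrable_const _) (hTi _), integral_const, probReal_univ, one_smul]
    have h2 : γ ^ t * (A * (1 + V (chain h q x k ω) + m)) =
        ∫ ω', γ ^ t * (A * (1 + V (chain h q x k ω) + V (chain h q x k ω'))) ∂driving := by
      rw [integral_const_mul, integral_const_mul, integral_add (integrable_const _) iV,
        integral_const, probReal_univ, one_smul]
    rw [h1, h2]
    exact (norm_integral_le_integral_norm _).trans (integral_mono
      ((integrable_const _).sub (hTi _)).norm
      ((((integrable_const _).add iV).const_mul A).const_mul _) fun ω' => hTd _ _ _)
  rw [← integral_sub hTj hTp]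
  have i1 : Integrable (fun ω => 1 + V (chain h q x k ω)) driving := (integrable_const _).add iV
  calc |∫ ω, (T (past ω) (chain h q x k ω) -
        ∫ ω', T (past ω) (chain h q x k ω') ∂driving) ∂driving|
      ≤ ∫ ω, γ ^ t * (A * (1 + V (chain h q x k ω) + m)) ∂driving :=
        (norm_integral_le_integral_norm _).trans (integral_mono (hTj.sub hTp).norm
          (((i1.add (integrable_const _)).const_mul A).const_mul _) hinner)
    _ = A * (1 + 2 * m) * γ ^ t := by
        rw [integral_const_mul, integral_const_mul, integral_add i1 (integrable_const _),
          integral_add (integrable_const _) iV, integral_const, integral_const, probReal_univ,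
          one_smul, one_smul, ← hm]
        ring
    _ ≤ _ := by gcongr

/-! ### The flow, and the change of variables along it. -/

variable {φ : ℝ → ℝ → ℝ} {f m M : ℝ → ℝ} {κ : ℝ}

theorem inv_apply {h : ℝ → ℝ} {t : Set ℝ} (hh : BijOn h (Ici 0) t) {x : ℝ} (hx : 0 ≤ x) :
    inv h (h x) = x :=
  hh.injOn.leftInvOn_invFunOn hx

theorem apply_inv {h : ℝ → ℝ} {t : Set ℝ} (hh : BijOn h (Ici 0) t) {y : ℝ} (hy : y ∈ t) :
    h (inv h y) = y :=
  Function.invFunOn_eq (hh.surjOn hy)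

theorem inv_nonneg_of_mem {h : ℝ → ℝ} {t : Set ℝ} (hh : BijOn h (Ici 0) t) {y : ℝ} (hy : y ∈ t) :
    0 ≤ inv h y :=
  Function.invFunOn_mem (hh.surjOn hy)

/-- Differentiability is forced by `0 < m ≤ g`: `derivWithin` would be `0` at a point of
non-differentiability. -/
theorem IsConstrained.hasDerivWithinAt_inv (hc : IsConstrained φ f m M κ) {x y : ℝ} (hx : 0 < x)
    (hy : f x ≤ y) :
    HasDerivWithinAt (inv fun t => f (φ x t)) (g φ f x y) (Ici (f x)) y := by
  have hpos : 0 < g φ f x y := (hc.m_pos y ((hc.jump_pos x hx).trans_le hy)).trans_le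
    (hc.m_le_g x hx y hy)
  have : DifferentiableWithinAt ℝ (inv fun t => f (φ x t)) (Ici (f x)) y := by
    by_contra hnd
    exact hpos.ne' (derivWithin_zero_of_not_differentiableWithinAt hnd)
  exact this.hasDerivWithinAt

namespace IsCharacteristics

variable (H : IsCharacteristics φ f)
include H

theorem jump_nonneg {x : ℝ} (hx : 0 ≤ x) : 0 ≤ f x := H.jump_diffeo.bijOn.mapsTo hx

theorem jump_zero : f 0 = 0 := by
  obtain ⟨x, hx, hx0⟩ := H.jump_diffeo.bijOn.surjOn self_mem_Ici
  exact le_antisymm (hx0 ▸ H.jump_strictMonoOn.monotoneOn self_mem_Ici hx hx)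
    (H.jump_nonneg le_rfl)

theorem jump_le_jump_iff {x y : ℝ} (hx : 0 ≤ x) (hy : 0 ≤ y) : f x ≤ f y ↔ x ≤ y :=
  H.jump_strictMonoOn.le_iff_le hx hy

theorem continuous_jump_max : Continuous fun x => f (max x 0) :=
  H.jump_diffeo.contDiffOn.continuousOn.comp_continuous (by fun_prop) fun _ => mem_Ici.2 (le_max_right _ _)

theorem flow_zero {x : ℝ} (hx : 0 ≤ x) : φ x 0 = x := by
  have h1 := H.flow_add x hx 0 le_rfl 0 le_rfl
  rw [add_zero] at h1
  have h2 := (H.flow_isEmbedding 0 le_rfl).injective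
    (a₁ := ⟨x, hx⟩) (a₂ := ⟨φ x 0, H.flow_nonneg x hx 0 le_rfl⟩) h1
  exact (congrArg Subtype.val h2).symm

theorem continuousOn_flow {x : ℝ} (hx : 0 ≤ x) : ContinuousOn (φ x) (Ici 0) :=
  H.flow_contDiffOn.continuousOn.comp (f := fun t : ℝ => (x, t)) (by fun_prop)
    fun _ ht => ⟨hx, ht⟩

theorem flow_sub {x s t : ℝ} (hx : 0 ≤ x) (hs : 0 ≤ s) (hst : s ≤ t) :
    φ (φ x s) (t - s) = φ x t := by
  rw [← H.flow_add x hx s hs (t - s) (sub_nonneg.2 hst), sub_add_cancel]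

theorem lt_flow {x t : ℝ} (hx : 0 < x) (ht : 0 < t) : x < φ x t := by
  refine lt_of_le_of_ne ((H.flow_diffeo x hx).bijOn.mapsTo ht.le) fun h => ?_
  refine ht.ne ((H.flow_diffeo x hx).bijOn.injOn self_mem_Ici ht.le ?_)
  rw [H.flow_zero hx.le]
  exact h

end IsCharacteristics

/-- The positions from which the flow is positive at positive times: all positions, except the
origin if it is a rest point. -/
def IsActive (φ : ℝ → ℝ → ℝ) (x : ℝ) : Prop := 0 ≤ x ∧ ∀ t > 0, 0 < φ x t

namespace IsCharacteristics

variable (H : IsCharacteristics φ f)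
include H

theorem isActive_of_pos {x : ℝ} (hx : 0 < x) : IsActive φ x :=
  ⟨hx.le, fun _ ht => hx.trans (H.lt_flow hx ht)⟩

/-- If `φ 0 t > 0` but `φ 0 s = 0` with `s > 0`, then computing `φ 0 (s + t)` in both orders gives
`φ (φ 0 t) s = φ 0 t`, whereas the flow strictly increases from positive points. -/
theorem isActive_zero_or : IsActive φ 0 ∨ ∀ t ≥ 0, φ 0 t = 0 := by
  by_contra! hcon
  obtain ⟨h1, t, ht, hφt⟩ := hcon
  have hpos : 0 < φ 0 t := lt_of_le_of_ne (H.flow_nonneg 0 le_rfl t ht) hφt.symm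
  refine h1 ⟨le_rfl, fun s hs => lt_of_le_of_ne (H.flow_nonneg 0 le_rfl s hs.le) fun h0 => ?_⟩
  have h2 := H.flow_add 0 le_rfl s hs.le t ht
  have h3 := H.flow_add 0 le_rfl t ht s hs.le
  rw [← h0] at h2
  rw [add_comm, h2] at h3
  exact (H.lt_flow hpos hs).ne h3

theorem flow_strictMonoOn {x : ℝ} (hx : IsActive φ x) : StrictMonoOn (φ x) (Ici 0) := by
  intro s hs t ht hst
  have hs' : 0 ≤ s := hs
  rcases hx.1.eq_or_lt with h0 | h0
  · rcases hs'.eq_or_lt with h1 | h1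
    · rw [← h1, H.flow_zero hx.1, ← h0]
      exact h0 ▸ hx.2 t (by linarith)
    · rw [← H.flow_sub hx.1 hs hst.le]
      exact H.lt_flow (hx.2 s h1) (sub_pos.2 hst)
  · rw [← H.flow_sub hx.1 hs hst.le]
    exact H.lt_flow (h0.trans_le ((H.flow_diffeo x h0).bijOn.mapsTo hs)) (sub_pos.2 hst)

theorem exists_flow_eq {x : ℝ} (hx : IsActive φ x) {y : ℝ} (hy : x ≤ y) :
    ∃ t ≥ 0, φ x t = y := by
  rcases hx.1.eq_or_lt with h0 | h0
  · rcases le_total (φ x 1) y with h1 | h1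
    · obtain ⟨t, ht, hty⟩ := (H.flow_diffeo _ (hx.2 1 one_pos)).bijOn.surjOn h1
      have ht' : 0 ≤ t := ht
      refine ⟨t + 1, by linarith, ?_⟩
      rw [H.flow_add x hx.1 1 zero_le_one t ht]
      exact hty
    · have := intermediate_value_Icc zero_le_one
        ((H.continuousOn_flow hx.1).mono Icc_subset_Ici_self)
      rw [H.flow_zero hx.1] at this
      obtain ⟨t, ht, hty⟩ := this ⟨hy, h1⟩
      exact ⟨t, ht.1, hty⟩
  · obtain ⟨t, ht, hty⟩ := (H.flow_diffeo x h0).bijOn.surjOn hy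
    exact ⟨t, ht, hty⟩

theorem bijOn_jump_flow {x : ℝ} (hx : 0 < x) :
    BijOn (fun t => f (φ x t)) (Ici 0) (Ici (f x)) := by
  refine BijOn.comp (g := f) ⟨fun y hy => ?_, ?_, fun u hu => ?_⟩ (H.flow_diffeo x hx).bijOn
  · exact (H.jump_le_jump_iff hx.le (hx.le.trans hy)).2 hy
  · exact H.jump_diffeo.bijOn.injOn.mono (Ici_subset_Ici.2 hx.le)
  · obtain ⟨y, hy, hyu⟩ := H.jump_diffeo.bijOn.surjOn ((H.jump_nonneg hx.le).trans hu)
    exact ⟨y, (H.jump_le_jump_iff hx.le hy).1 (hyu ▸ hu), hyu⟩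

/-- The derivative `g_x(y)` does not depend on `x`. -/
theorem g_eq (hc : IsConstrained φ f m M κ) {x y : ℝ} (hx : 0 < x) (hy : f x ≤ y) :
    g φ f (inv f y) y = g φ f x y := by
  have hy0 : y ∈ Ici (0 : ℝ) := (H.jump_nonneg hx.le).trans hy
  set x' := inv f y with hx'
  have hfx' : f x' = y := apply_inv H.jump_diffeo.bijOn hy0
  have hx'0 : 0 ≤ x' := inv_nonneg_of_mem H.jump_diffeo.bijOn hy0
  have hxx' : x ≤ x' := (H.jump_le_jump_iff hx.le hx'0).1 (hfx'.symm ▸ hy)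
  have hx'p : 0 < x' := hx.trans_le hxx'
  -- If the trajectory from `x` reaches `x'` after time `s`, the two inverse functions differ by the
  -- constant `s` on the smaller domain.
  obtain ⟨s, hs, hsx⟩ := H.exists_flow_eq (H.isActive_of_pos hx) hxx'
  have h1 := ((hc.hasDerivWithinAt_inv hx hy).mono (Ici_subset_Ici.2 (hfx'.symm ▸ hy) :
    Ici (f x') ⊆ Ici (f x))).sub_const s
  have h2 : HasDerivWithinAt (inv fun t => f (φ x' t)) (g φ f x y) (Ici (f x')) y := by
    refine h1.congr_of_mem (fun u hu => ?_) hfx'.le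
    obtain ⟨t, ht, rfl⟩ := (H.bijOn_jump_flow hx'p).surjOn hu
    have ht' : 0 ≤ t := ht
    have h3 : f (φ x' t) = (fun t => f (φ x t)) (t + s) := by
      simp only
      rw [H.flow_add x hx.le s hs t ht, hsx]
    rw [inv_apply (h := fun t => f (φ x' t)) (H.bijOn_jump_flow hx'p) ht]
    simp only [h3]
    rw [inv_apply (h := fun t => f (φ x t)) (H.bijOn_jump_flow hx) (by linarith), add_sub_cancel_right]
  exact h2.derivWithin (uniqueDiffOn_Ici _ y hfx'.le)

/-- The substitution is `s = ψ u`, with `ψ` inverse to `t ↦ f (φ x t)`. By `g_eq` the resulting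
integrand no longer involves the starting point. -/
theorem cumRate_eq_setIntegral (hc : IsConstrained φ f m M κ) {lam : ℝ → ℝ}
    (hlam : ContinuousOn lam (Ici 0)) {x t : ℝ} (hx : 0 < x) (ht : 0 ≤ t) :
    IntegrableOn (fun u => g φ f (inv f u) u * lam (inv f u)) (Icc (f x) (f (φ x t))) ∧
      cumRate φ lam x t =
        ∫ u in Icc (f x) (f (φ x t)), g φ f (inv f u) u * lam (inv f u) := by
  have hbij := H.bijOn_jump_flow hx
  have hact := H.isActive_of_pos hx
  set ψ := inv fun t => f (φ x t) with hψ
  have hmono : StrictMonoOn (fun t => f (φ x t)) (Ici 0) := fun s hs t ht hst =>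
    H.jump_strictMonoOn (H.flow_nonneg x hx.le s hs) (H.flow_nonneg x hx.le t ht)
      (H.flow_strictMonoOn hact hs ht hst)
  have hderiv : ∀ u ∈ Icc (f x) (f (φ x t)),
      HasDerivWithinAt ψ (g φ f x u) (Icc (f x) (f (φ x t))) u := fun u hu =>
    (hc.hasDerivWithinAt_inv hx hu.1).mono Icc_subset_Ici_self
  have hinj : InjOn ψ (Icc (f x) (f (φ x t))) := by
    intro u hu v hv huv
    rw [← apply_inv hbij (show u ∈ Ici (f x) from hu.1),
      ← apply_inv hbij (show v ∈ Ici (f x) from hv.1)]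
    simp only [← hψ, huv]
  have himage : ψ '' Icc (f x) (f (φ x t)) = Icc 0 t := by
    ext s
    constructor
    · rintro ⟨u, hu, rfl⟩
      have h0 : 0 ≤ ψ u := inv_nonneg_of_mem hbij hu.1
      refine ⟨h0, (hmono.le_iff_le h0 ht).1 ?_⟩
      exact (apply_inv hbij hu.1).le.trans hu.2
    · intro hs
      exact ⟨f (φ x s), ⟨hbij.mapsTo hs.1, (hmono.le_iff_le hs.1 ht).2 hs.2⟩,
        inv_apply hbij hs.1⟩
  have hcont : ContinuousOn (fun s => lam (φ x s)) (Icc 0 t) :=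
    hlam.comp ((H.continuousOn_flow hx.le).mono Icc_subset_Ici_self)
      fun s hs => H.flow_nonneg x hx.le s hs.1
  have hcongr : ∀ u ∈ Icc (f x) (f (φ x t)), |g φ f x u| • lam (φ x (ψ u)) =
      g φ f (inv f u) u * lam (inv f u) := by
    intro u hu
    have hpos : 0 < g φ f x u := (hc.m_pos u ((hc.jump_pos x hx).trans_le hu.1)).trans_le
      (hc.m_le_g x hx u hu.1)
    have h1 : f (φ x (ψ u)) = u := apply_inv hbij hu.1
    have h2 : inv f u = φ x (ψ u) := by
      conv_lhs => rw [← h1]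
      exact inv_apply H.jump_diffeo.bijOn
        (H.flow_nonneg x hx.le _ (inv_nonneg_of_mem hbij hu.1))
    rw [abs_of_pos hpos, H.g_eq hc hx hu.1, h2, smul_eq_mul]
  constructor
  · refine IntegrableOn.congr_fun ?_ hcongr measurableSet_Icc
    rw [← integrableOn_image_iff_integrableOn_abs_deriv_smul measurableSet_Icc hderiv hinj
      (fun s => lam (φ x s)), himage]
    exact hcont.integrableOn_Icc
  · rw [← setIntegral_congr_fun measurableSet_Icc hcongr,
      ← integral_image_eq_integral_abs_deriv_smul measurableSet_Icc hderiv hinj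
      (fun s => lam (φ x s)), himage, cumRate, intervalIntegral.integral_of_le ht,
      integral_Icc_eq_integral_Ioc]

end IsCharacteristics

/-! ### The hazard primitive. -/

/-- A primitive `C` of the hazard rate of the position after a jump: the cumulated jump rate along
the flow is its increment. -/
structure IsHazard (φ : ℝ → ℝ → ℝ) (f lam : ℝ → ℝ) (r θ b L : ℝ) (C : ℝ → ℝ) : Prop where
  continuous : Continuous C
  monotone : Monotone C
  zero : C 0 = 0
  le : C (f r) ≤ L
  increment_le : ∀ y₁ ≥ f r, ∀ y₂ ≥ y₁, θ * (y₂ ^ (b + 1) - y₁ ^ (b + 1)) ≤ C y₂ - C y₁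
  cumRate_eq : ∀ x, IsActive φ x → ∀ t ≥ 0, cumRate φ lam x t = C (f (φ x t)) - C (f x)

namespace IsCharacteristics

variable (H : IsCharacteristics φ f)
include H

/-- Needed only for an active origin: the identity holds from `φ x s` for every `s > 0`, and both
sides are continuous as `s → 0`. -/
theorem cumRate_eq_of_forall_pos {lam C : ℝ → ℝ} (hlam : ContinuousOn lam (Ici 0))
    (hC : Continuous C)
    (hpos : ∀ x > 0, ∀ t ≥ 0, cumRate φ lam x t = C (f (φ x t)) - C (f x)) {x : ℝ}
    (hx : IsActive φ x) {t : ℝ} (ht : 0 ≤ t) :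
    cumRate φ lam x t = C (f (φ x t)) - C (f x) := by
  have hc : ContinuousOn (fun s => lam (φ x s)) (Ici 0) :=
    hlam.comp (H.continuousOn_flow hx.1) fun s hs => H.flow_nonneg x hx.1 s hs
  have hi : ∀ s ≥ 0, ∀ t ≥ 0, IntervalIntegrable (fun s => lam (φ x s)) volume s t :=
    fun s hs t ht => (hc.mono fun u hu => (le_min hs ht).trans hu.1).intervalIntegrable
  rcases ht.eq_or_lt with h0 | h0
  · rw [← h0, H.flow_zero hx.1]
    simp [cumRate]
  have hconst : ∀ s ∈ Ioc 0 t, cumRate φ lam x s - C (f (φ x s)) =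
      cumRate φ lam x t - C (f (φ x t)) := by
    intro s hs
    have h1 := hpos (φ x s) (hx.2 s hs.1) (t - s) (sub_nonneg.2 hs.2)
    rw [H.flow_sub hx.1 hs.1.le hs.2] at h1
    have h2 : cumRate φ lam (φ x s) (t - s) = ∫ u in s..t, lam (φ x u) := by
      have h3 := intervalIntegral.integral_comp_add_right (fun u => lam (φ x u)) s
        (a := 0) (b := t - s)
      rw [zero_add, sub_add_cancel] at h3
      rw [← h3, cumRate]
      refine intervalIntegral.integral_congr fun u hu => ?_
      rw [uIcc_of_le (sub_nonneg.2 hs.2)] at hu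
      rw [H.flow_add x hx.1 s hs.1.le u hu.1]
    have h4 := intervalIntegral.integral_add_adjacent_intervals (hi 0 le_rfl s hs.1.le)
      (hi s hs.1.le t ht)
    simp only [cumRate] at *
    linarith
  have hF : ContinuousOn (fun s => cumRate φ lam x s - C (f (φ x s))) (Icc 0 t) := by
    refine ContinuousOn.sub ?_ ?_
    · have := intervalIntegral.continuousOn_primitive_interval (μ := volume) (a := 0) (b := t)
        (f := fun s => lam (φ x s)) ?_
      · rwa [uIcc_of_le ht] at this
      · rw [uIcc_of_le ht]
        exact (hc.mono Icc_subset_Ici_self).integrableOn_Icc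
    · refine hC.comp_continuousOn (H.jump_diffeo.contDiffOn.continuousOn.comp
        ((H.continuousOn_flow hx.1).mono Icc_subset_Ici_self) fun s hs => ?_)
      exact H.flow_nonneg x hx.1 s hs.1
  have h5 : Filter.Tendsto (fun s => cumRate φ lam x s - C (f (φ x s))) (nhdsWithin 0 (Ioc 0 t))
      (nhds (cumRate φ lam x 0 - C (f (φ x 0)))) :=
    ((hF 0 (left_mem_Icc.2 ht)).mono Ioc_subset_Icc_self)
  have h6 : Filter.Tendsto (fun s => cumRate φ lam x s - C (f (φ x s))) (nhdsWithin 0 (Ioc 0 t))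
      (nhds (cumRate φ lam x t - C (f (φ x t)))) := by
    refine tendsto_const_nhds.congr' ?_
    filter_upwards [self_mem_nhdsWithin] with s hs
    exact (hconst s hs).symm
  have : (nhdsWithin (0 : ℝ) (Ioc 0 t)).NeBot := by
    rw [nhdsWithin_Ioc_eq_nhdsGT h0]
    infer_instance
  have h7 := tendsto_nhds_unique h5 h6
  rw [H.flow_zero hx.1] at h7
  have h8 : cumRate φ lam x 0 = 0 := by simp [cumRate]
  linarith

/-- The hazard rate at `u` is `d u = g (u) * lam (f⁻¹ u)`. The bound `g ≤ M` and the integral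
condition control it on `(0, f r]`; the bound `g ≥ m` and the lower bound on `lam` give `d u ≥ a
u^b` for `u ≥ f r`. -/
theorem exists_isHazard (hc : IsConstrained φ f m M κ) {lam : ℝ → ℝ} {r L a b : ℝ}
    (hr : 0 < r) (ha : 0 < a) (hb : 0 < b) (hlam : RateClass f m M r L a b lam) :
    ∃ C, IsHazard φ f lam r (a / (b + 1)) b L C := by
  have hfr : 0 < f r := hc.jump_pos r hr
  have hbij := H.jump_diffeo.bijOn
  set d : ℝ → ℝ := fun u => g φ f (inv f u) u * lam (inv f u) with hd
  have hinv : ∀ u > 0, 0 < inv f u ∧ f (inv f u) = u := by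
    intro u hu
    have h1 : f (inv f u) = u := apply_inv hbij hu.le
    refine ⟨lt_of_le_of_ne (inv_nonneg_of_mem hbij hu.le) fun h => ?_, h1⟩
    rw [← h, H.jump_zero] at h1
    exact hu.ne h1
  have hgm : ∀ u > 0, m u ≤ g φ f (inv f u) u := fun u hu =>
    hc.m_le_g _ (hinv u hu).1 u (hinv u hu).2.le
  have hgM : ∀ u > 0, g φ f (inv f u) u ≤ M u := fun u hu =>
    hc.g_le_M _ (hinv u hu).1 u (hinv u hu).2.le
  have hlam0 : ∀ u > 0, 0 ≤ lam (inv f u) := fun u hu => hlam.nonneg _ (hinv u hu).1.le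
  have hd0 : ∀ u > 0, 0 ≤ d u := fun u hu =>
    mul_nonneg ((hc.m_pos u hu).le.trans (hgm u hu)) (hlam0 u hu)
  have hdM : ∀ u > 0, d u ≤ M u * lam (inv f u) := fun u hu =>
    mul_le_mul_of_nonneg_right (hgM u hu) (hlam0 u hu)
  have hi1 : ∀ u > 0, ∀ v, IntegrableOn d (Ioc u v) := by
    intro u hu v
    rcases le_total u v with huv | huv
    · obtain ⟨hxp, hxu⟩ := hinv u hu
      obtain ⟨hyp, hyv⟩ := hinv v (hu.trans_le huv)
      obtain ⟨t, ht, hty⟩ := H.exists_flow_eq (H.isActive_of_pos hxp)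
        ((H.jump_le_jump_iff hxp.le hyp.le).1 (hxu.symm ▸ hyv.symm ▸ huv))
      have := (H.cumRate_eq_setIntegral hc hlam.continuousOn hxp ht).1
      rw [hty, hxu, hyv] at this
      exact this.mono_set Ioc_subset_Icc_self
    · rw [Ioc_eq_empty huv.not_gt]
      exact integrableOn_empty
  -- The flow formula gives integrability only away from `0`; domination by `M u * lam (inv f u)`
  -- lets the lower endpoint tend to `0`.
  have hi2 : IntegrableOn d (Ioc 0 (f r)) := by
    refine integrableOn_Ioc_of_intervalIntegral_norm_bounded_left
      (I := ∫ u in Ioc 0 (f r), M u * lam (inv f u)) (l := Filter.atTop)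
      (a := fun n : ℕ => 1 / ((n : ℝ) + 1)) (fun n => hi1 _ (by positivity) _)
      tendsto_one_div_add_atTop_nhds_zero_nat (Filter.Eventually.of_forall fun n => ?_)
    have hsub : Ioc (1 / ((n : ℝ) + 1)) (f r) ⊆ Ioc 0 (f r) :=
      Ioc_subset_Ioc_left (by positivity)
    calc ∫ u in Ioc (1 / ((n : ℝ) + 1)) (f r), ‖d u‖
        ≤ ∫ u in Ioc (1 / ((n : ℝ) + 1)) (f r), M u * lam (inv f u) := by
          refine setIntegral_mono_on (hi1 _ (by positivity) _).norm
            (hlam.integrableOn.mono_set hsub) measurableSet_Ioc fun u hu => ?_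
          have hu0 := (hsub hu).1
          rw [Real.norm_eq_abs, abs_of_nonneg (hd0 u hu0)]
          exact hdM u hu0
      _ ≤ ∫ u in Ioc 0 (f r), M u * lam (inv f u) := by
          refine setIntegral_mono_set hlam.integrableOn ?_ hsub.eventuallyLE
          filter_upwards [ae_restrict_mem measurableSet_Ioc] with u hu
          exact (hd0 u hu.1).trans (hdM u hu.1)
  have hi3 : ∀ v, IntegrableOn d (Ioc 0 v) := fun v =>
    (hi2.union (hi1 (f r) hfr v)).mono_set fun u hu => by
      rcases le_or_gt u (f r) with h | h
      · exact Or.inl ⟨hu.1, h⟩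
      · exact Or.inr ⟨h, hu.2⟩
  -- Extension by zero makes the primitive continuous and monotone on all of `ℝ`.
  set D := (Ioi (0 : ℝ)).indicator d with hD
  have hDd : ∀ u > 0, D u = d u := fun u hu => indicator_of_mem hu d
  have hD0 : ∀ u, 0 ≤ D u := fun u => indicator_nonneg (fun u hu => hd0 u hu) u
  have hi4 : ∀ v, IntegrableOn D (Iic v) := by
    intro v
    rw [IntegrableOn, hD, integrable_indicator_iff measurableSet_Ioi, IntegrableOn,
      Measure.restrict_restrict measurableSet_Ioi]
    exact hi3 v
  have hi5 : ∀ u v, IntervalIntegrable D volume u v := fun u v =>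
    ⟨(hi4 v).mono_set fun _ h => h.2, (hi4 u).mono_set fun _ h => h.2⟩
  have hsub : ∀ u v, (∫ z in (0 : ℝ)..v, D z) - ∫ z in (0 : ℝ)..u, D z = ∫ z in u..v, D z :=
    fun u v => intervalIntegral.integral_interval_sub_left (hi5 _ _) (hi5 _ _)
  have hDI : ∀ u ≥ 0, ∀ v ≥ u, ∫ z in u..v, D z = ∫ z in Ioc u v, d z := by
    intro u hu v huv
    rw [intervalIntegral.integral_of_le huv]
    exact setIntegral_congr_fun measurableSet_Ioc fun z hz => hDd z (hu.trans_lt hz.1)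
  have hcontC : Continuous fun y => ∫ u in (0 : ℝ)..y, D u :=
    intervalIntegral.continuous_primitive hi5 0
  refine ⟨fun y => ∫ u in (0 : ℝ)..y, D u, hcontC, fun u v huv => ?_, ?_, ?_,
    fun u hu v huv => ?_, fun x hx t ht => ?_⟩
  · have := intervalIntegral.integral_nonneg_of_forall (μ := volume) huv hD0
    rw [← hsub] at this
    exact sub_nonneg.1 this
  · simp
  · refine le_trans ?_ hlam.integral_le
    rw [hDI 0 le_rfl _ hfr.le, intervalIntegral.integral_of_le hfr.le]
    exact setIntegral_mono_on (hi3 _) hlam.integrableOn measurableSet_Ioc fun u hu => hdM u hu.1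
  · have hu0 : 0 < u := hfr.trans_le hu
    have h1 : ∫ z in u..v, a * z ^ b = a / (b + 1) * (v ^ (b + 1) - u ^ (b + 1)) := by
      rw [intervalIntegral.integral_const_mul, integral_rpow (Or.inl (by linarith))]
      ring
    rw [hsub, ← h1]
    refine intervalIntegral.integral_mono_on huv
      ((intervalIntegral.intervalIntegrable_rpow' (by linarith)).const_mul a) (hi5 _ _)
      fun z hz => ?_
    have hz0 : 0 < z := hu0.trans_le hz.1
    obtain ⟨hxp, hxz⟩ := hinv z hz0
    have hm := hc.m_pos z hz0
    have h2 := hlam.lower_bound (inv f z)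
      ((H.jump_le_jump_iff hr.le hxp.le).1 (hxz.symm ▸ hu.le.trans hz.1))
    rw [hxz, div_le_div_iff₀ hm ha] at h2
    rw [hDd z hz0]
    calc a * z ^ b = z ^ b * a := mul_comm _ _
      _ ≤ lam (inv f z) * m z := h2
      _ ≤ lam (inv f z) * g φ f (inv f z) z :=
          mul_le_mul_of_nonneg_left (hgm z hz0) (hlam0 z hz0)
      _ = d z := mul_comm _ _
  · refine H.cumRate_eq_of_forall_pos hlam.continuousOn hcontC (fun x hx t ht => ?_) hx ht
    have hxt : f x ≤ f (φ x t) := (H.bijOn_jump_flow hx).mapsTo ht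
    rw [hsub, hDI _ (H.jump_nonneg hx.le) _ hxt,
      (H.cumRate_eq_setIntegral hc hlam.continuousOn hx ht).2, integral_Icc_eq_integral_Ioc]

end IsCharacteristics

/-! ### The jump chain as a recursion driven by exponential noise. -/

/-- The left-continuous inverse of an increasing function on `[0,∞)`. -/
noncomputable def leftInv (C : ℝ → ℝ) (c : ℝ) : ℝ := sInf {y | 0 ≤ y ∧ c ≤ C y}

namespace IsHazard

variable {lam C : ℝ → ℝ} {r θ b L : ℝ}

theorem nonneg (hC : IsHazard φ f lam r θ b L C) {y : ℝ} (hy : 0 ≤ y) : 0 ≤ C y :=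
  hC.zero ▸ hC.monotone hy

theorem exists_le (hC : IsHazard φ f lam r θ b L C) (hfr : 0 < f r) (hθ : 0 < θ) (hb : 0 < b)
    (c : ℝ) : ∃ y, 0 ≤ y ∧ c ≤ C y := by
  have h1 : Filter.Tendsto (fun y : ℝ => θ * (y ^ (b + 1) - f r ^ (b + 1))) Filter.atTop
      Filter.atTop :=
    (Filter.tendsto_atTop_add_const_right _ _
      (tendsto_rpow_atTop (by linarith : 0 < b + 1))).const_mul_atTop hθ
  obtain ⟨y, hy1, hy2⟩ :=
    ((h1.eventually_ge_atTop c).and (Filter.eventually_ge_atTop (f r))).exists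
  refine ⟨y, hfr.le.trans hy2, ?_⟩
  linarith [hC.increment_le (f r) le_rfl y hy2, hC.nonneg hfr.le]

theorem isLeast_leftInv (hC : IsHazard φ f lam r θ b L C) (hfr : 0 < f r) (hθ : 0 < θ)
    (hb : 0 < b) (c : ℝ) : IsLeast {y | 0 ≤ y ∧ c ≤ C y} (leftInv C c) := by
  have hbdd : BddBelow {y | 0 ≤ y ∧ c ≤ C y} := ⟨0, fun _ hy => hy.1⟩
  refine ⟨IsClosed.csInf_mem ?_ (hC.exists_le hfr hθ hb c) hbdd, fun y hy => csInf_le hbdd hy⟩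
  exact isClosed_Ici.inter (isClosed_Ici.preimage hC.continuous)

theorem monotone_leftInv (hC : IsHazard φ f lam r θ b L C) (hfr : 0 < f r) (hθ : 0 < θ)
    (hb : 0 < b) : Monotone (leftInv C) := fun c c' hcc =>
  (hC.isLeast_leftInv hfr hθ hb c).2 ⟨(hC.isLeast_leftInv hfr hθ hb c').1.1,
    hcc.trans (hC.isLeast_leftInv hfr hθ hb c').1.2⟩

theorem apply_leftInv (hC : IsHazard φ f lam r θ b L C) (hfr : 0 < f r) (hθ : 0 < θ)
    (hb : 0 < b) {c : ℝ} (hc : 0 ≤ c) : C (leftInv C c) = c := by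
  have hl := hC.isLeast_leftInv hfr hθ hb c
  obtain ⟨y, hy, hyc⟩ := intermediate_value_Icc hl.1.1 hC.continuous.continuousOn
    ⟨hC.zero.trans_le hc, hl.1.2⟩
  have := hl.2 ⟨hy.1, hyc.ge⟩
  rw [le_antisymm this hy.2, hyc]

/-- Both sides are first hitting times: along an increasing trajectory, the first `t` at which the
cumulated rate reaches `e` corresponds to the first post-jump position at which `C` reaches `C (f x)
+ e`. This remains true where `C` is flat. The strict inequality keeps the chain positive after each
jump. -/
theorem jump_flow_waitingTime (hC : IsHazard φ f lam r θ b L C) (H : IsCharacteristics φ f)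
    (hfr : 0 < f r) (hθ : 0 < θ) (hb : 0 < b) {x e : ℝ} (hx : IsActive φ x) (he : 0 < e) :
    f (φ x (waitingTime φ lam x e)) = leftInv C (C (f x) + e) ∧
      f x < leftInv C (C (f x) + e) := by
  have hl := hC.isLeast_leftInv hfr hθ hb (C (f x) + e)
  set y := leftInv C (C (f x) + e) with hy
  have hlt : f x < y := by
    by_contra! hle
    linarith [hC.monotone hle, hl.1.2]
  refine ⟨?_, hlt⟩
  obtain ⟨z, hz, hzy⟩ := H.jump_diffeo.bijOn.surjOn (show y ∈ Ici 0 from hl.1.1)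
  obtain ⟨t, ht, rfl⟩ := H.exists_flow_eq hx
    ((H.jump_le_jump_iff hx.1 hz).1 (hzy.symm ▸ hlt.le))
  have hleast : IsLeast {t : ℝ | 0 ≤ t ∧ e ≤ cumRate φ lam x t} t := by
    refine ⟨⟨ht, ?_⟩, fun s hs => ?_⟩
    · rw [hC.cumRate_eq x hx t ht, hzy]
      linarith [hl.1.2]
    · have hs2 := hs.2
      rw [hC.cumRate_eq x hx s hs.1] at hs2
      have h1 := H.flow_nonneg x hx.1 s hs.1
      have h2 : y ≤ f (φ x s) := hl.2 ⟨H.jump_nonneg h1, by linarith⟩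
      rw [← hzy] at h2
      exact ((H.flow_strictMonoOn hx).le_iff_le ht hs.1).1 ((H.jump_le_jump_iff hz h1).1 h2)
  rw [waitingTime, hleast.csInf_eq, hzy]

theorem isLyapunov (hC : IsHazard φ f lam r θ b L C) (H : IsCharacteristics φ f)
    (hcon : IsConstrained φ f m M κ) (hr : 0 < r) (hθ : 0 < θ) (hb : 0 < b) :
    IsLyapunov (fun x => C (f (max x 0))) (leftInv C) (fun x => θ * max x r ^ (b + 1))
      (κ ^ (b + 1)) (θ * r ^ (b + 1)) L := by
  have hfr : 0 < f r := hcon.jump_pos r hr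
  have hb1 : 0 < b + 1 := by linarith
  have hmonoV : Monotone fun x => θ * max x r ^ (b + 1) := by
    intro x y hxy
    have : 0 ≤ max x r := hr.le.trans (le_max_right _ _)
    simp only
    gcongr
  refine ⟨(hC.continuous.comp H.continuous_jump_max).measurable,
    (hC.monotone_leftInv hfr hθ hb).measurable, hmonoV.measurable, fun x => ?_,
    fun x e he => ?_, fun x hx => ?_, hmonoV.comp (hC.monotone_leftInv hfr hθ hb)⟩
  · have := le_max_right x r
    gcongr
  · set x' := max x 0 with hx'
    have hx'0 : 0 ≤ x' := le_max_right _ _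
    have hfx' : 0 ≤ f x' := H.jump_nonneg hx'0
    have hc0 : 0 ≤ C (f x') + e := add_nonneg (hC.nonneg hfx') he
    have hz : C (leftInv C (C (f x') + e)) = C (f x') + e := hC.apply_leftInv hfr hθ hb hc0
    set z := leftInv C (C (f x') + e) with hzdef
    rcases le_or_gt z r with hzr | hzr
    · rw [max_eq_right hzr]
      exact le_max_left _ _
    refine le_trans ?_ (le_max_right _ _)
    rw [max_eq_left hzr.le]
    -- The growth of `C` is known only above `f r`, so it is applied from `y`; monotonicity of `C`
    -- covers the stretch below, and `y ≤ κ * max x r` produces the factor `κ ^ (b + 1)`.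
    set y := max (f x') (f r) with hy
    have hy0 : 0 ≤ y := hfx'.trans (le_max_left _ _)
    have hmax : 0 ≤ max x r := hr.le.trans (le_max_right _ _)
    have hyκ : y ≤ κ * max x r := by
      refine max_le ?_ ((hcon.jump_le r hr).trans
        (mul_le_mul_of_nonneg_left (le_max_right _ _) hcon.kappa_pos.le))
      rcases hx'0.eq_or_lt with h0 | h0
      · rw [← h0, H.jump_zero]
        exact mul_nonneg hcon.kappa_pos.le hmax
      · refine (hcon.jump_le x' h0).trans (mul_le_mul_of_nonneg_left ?_ hcon.kappa_pos.le)
        exact max_le (le_max_left _ _) hmax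
    have hyV : θ * y ^ (b + 1) ≤ κ ^ (b + 1) * (θ * max x r ^ (b + 1)) := by
      calc θ * y ^ (b + 1) ≤ θ * (κ * max x r) ^ (b + 1) := by gcongr
        _ = _ := by rw [Real.mul_rpow hcon.kappa_pos.le hmax]; ring
    rcases le_or_gt z y with hzy | hzy
    · have hz0 : 0 ≤ z := hr.le.trans hzr.le
      have : θ * z ^ (b + 1) ≤ θ * y ^ (b + 1) := by gcongr
      linarith
    · have h1 := hC.increment_le y (le_max_right _ _) z hzy.le
      have h2 := hC.monotone (le_max_left (f x') (f r))
      rw [hz] at h1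
      rw [mul_sub] at h1
      linarith
  · have h1 : max x r ^ (b + 1) ≤ r ^ (b + 1) := le_of_mul_le_mul_left hx hθ
    have h2 : max x r ≤ r := (Real.rpow_le_rpow_iff (hr.le.trans (le_max_right _ _)) hr.le hb1).1 h1
    have h3 : max x 0 ≤ r := max_le ((le_max_left _ _).trans h2) hr.le
    exact ⟨hC.nonneg (H.jump_nonneg (le_max_right _ _)), (hC.monotone
      ((H.jump_le_jump_iff (le_max_right _ _) hr.le).2 h3)).trans hC.le⟩

theorem jumpChain_eq_chain (hC : IsHazard φ f lam r θ b L C) (H : IsCharacteristics φ f)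
    (hfr : 0 < f r) (hθ : 0 < θ) (hb : 0 < b) {x : ℝ} (hx : IsActive φ x) {ω : ℕ → ℝ}
    (hω : ∀ n, 0 < ω n) (n : ℕ) :
    jumpChain φ f lam x n ω = chain (fun x => C (f (max x 0))) (leftInv C) x n ω ∧
      IsActive φ (jumpChain φ f lam x n ω) := by
  induction n with
  | zero => exact ⟨rfl, hx⟩
  | succ n ih =>
    obtain ⟨h1, h2⟩ := hC.jump_flow_waitingTime H hfr hθ hb ih.2 (hω n)
    simp only [jumpChain, chain]
    refine ⟨?_, ?_⟩
    · rw [h1, ← ih.1, max_eq_left ih.2.1]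
    · rw [h1]
      exact H.isActive_of_pos ((H.jump_nonneg ih.2.1).trans_lt h2)

end IsHazard

theorem IsCharacteristics.jumpChain_eq_zero (H : IsCharacteristics φ f)
    (h0 : ∀ t ≥ 0, φ 0 t = 0) (lam : ℝ → ℝ) (n : ℕ) (ω : ℕ → ℝ) :
    jumpChain φ f lam 0 n ω = 0 := by
  induction n with
  | zero => rfl
  | succ n ih =>
    have hw : 0 ≤ waitingTime φ lam 0 (ω n) := Real.sInf_nonneg fun t ht => ht.1
    rw [jumpChain, ih, h0 _ hw, H.jump_zero]

/-- Covers the start at a resting origin, where the chain stays at `0`, with the same `V`, `v₀` and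
`L` as in the general case. -/
theorem isLyapunov_zero {r θ b L ρ : ℝ} (hb : 0 < b) (hr : 0 < r) (hθ : 0 < θ) (hL : 0 < L) :
    IsLyapunov (fun _ => 0) (fun _ => 0) (fun x => θ * max x r ^ (b + 1)) ρ
      (θ * r ^ (b + 1)) L where
  measurable_h := measurable_const
  measurable_q := measurable_const
  measurable_V := by fun_prop
  le_V x := by
    have := le_max_right x r
    gcongr
  V_step_le x e he := by
    simp only [max_eq_right hr.le]
    exact le_max_left _ _
  h_mem x _ := ⟨le_rfl, hL.le⟩
  mono := monotone_const

/-- The jump chain agrees almost surely with a chain which has a Lyapunov function that does not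
depend on the jump rate. -/
theorem IsCharacteristics.exists_isLyapunov_chain (H : IsCharacteristics φ f)
    (hcon : IsConstrained φ f m M κ) {lam : ℝ → ℝ} {r L a b : ℝ} (hL : 0 < L) (ha : 0 < a)
    (hb : 0 < b) (hr : 0 < r) (hlam : RateClass f m M r L a b lam) {x : ℝ} (hx : 0 ≤ x) :
    ∃ h q, IsLyapunov h q (fun x => a / (b + 1) * max x r ^ (b + 1)) (κ ^ (b + 1))
      (a / (b + 1) * r ^ (b + 1)) L ∧
      ∀ᵐ ω ∂driving, ∀ n, jumpChain φ f lam x n ω = chain h q x n ω := by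
  have hθ : 0 < a / (b + 1) := by positivity
  by_cases hact : IsActive φ x
  · obtain ⟨C, hC⟩ := H.exists_isHazard hcon hr ha hb hlam
    refine ⟨_, _, hC.isLyapunov H hcon hr hθ hb, ?_⟩
    filter_upwards [ae_pos_driving] with ω hω n
    exact (hC.jumpChain_eq_chain H (hcon.jump_pos r hr) hθ hb hact hω n).1
  · have hx0 : x = 0 := by
      by_contra h
      exact hact (H.isActive_of_pos (lt_of_le_of_ne hx (Ne.symm h)))
    subst hx0
    refine ⟨_, _, isLyapunov_zero hb hr hθ hL, Filter.Eventually.of_forall fun ω n => ?_⟩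
    rw [H.jumpChain_eq_zero (H.isActive_zero_or.resolve_left hact)]
    cases n <;> rfl

end PDMP

/-! ### Conclusion, with constants independent of the jump rate. -/

theorem mainTheorem5 (φ : ℝ → ℝ → ℝ) (f m M : ℝ → ℝ) (κ r L a b : ℝ)
    (hφf : PDMP.IsCharacteristics φ f) (hcon : PDMP.IsConstrained φ f m M κ)
    (hL : 0 < L) (ha : 0 < a) (hb : 0 < b) (hr : 0 < r)
    (hr' : PDMP.inv f ((-Real.log (1 - κ ^ (b + 1)) / (1 - κ ^ (b + 1))) ^ (1 / (b + 1))) ≤ r) :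
    ∃ γ : ℝ, 0 < γ ∧ γ < 1 ∧ ∀ x₀ : ℝ, 0 ≤ x₀ →
      (∀ lam : ℝ → ℝ, PDMP.RateClass f m M r L a b lam →
        PDMP.IsGeometricallyBetaMixing PDMP.driving (PDMP.jumpChain φ f lam x₀)) ∧
      ∃ c : ℝ, 0 < c ∧ ∀ t : ℕ,
        (⨆ (lam : ℝ → ℝ) (_ : PDMP.RateClass f m M r L a b lam),
          PDMP.betaCoeff PDMP.driving (PDMP.jumpChain φ f lam x₀) t)
            ≤ ENNReal.ofReal (c * γ ^ t) := by
  have hθ : 0 < a / (b + 1) := by positivity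
  have hρ : 0 < κ ^ (b + 1) := Real.rpow_pos_of_pos hcon.kappa_pos _
  have hρ1 : κ ^ (b + 1) < 1 :=
    Real.rpow_lt_one hcon.kappa_pos.le hcon.kappa_lt_one (by linarith)
  have hv₀ : 0 < a / (b + 1) * r ^ (b + 1) := by positivity
  -- The weight, `γ` and `A` depend only on `κ ^ (b + 1)`, `v₀` and `L`, and are fixed before `x₀`
  -- and `lam`.
  obtain ⟨w, γ, A, hγ0, hγ1, hw⟩ := PDMP.exists_isWeight hρ hρ1 hv₀ hL
  have hA : 0 < A := by
    have := (hw.one_le 0).trans (hw.le 0)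
    simp at this
    linarith
  have hρ' : 0 < 1 - κ ^ (b + 1) := by linarith
  refine ⟨γ, hγ0, hγ1, fun x₀ hx₀ => ?_⟩
  set c := A * (1 + 2 * (a / (b + 1) * max x₀ r ^ (b + 1) +
    (a / (b + 1) * r ^ (b + 1) + 1) / (1 - κ ^ (b + 1)))) with hc
  have hmax : 0 < max x₀ r := hr.trans_le (le_max_right _ _)
  have hc0 : 0 < c := by positivity
  have key : ∀ lam : ℝ → ℝ, PDMP.RateClass f m M r L a b lam → ∀ t : ℕ,
      PDMP.betaCoeff PDMP.driving (PDMP.jumpChain φ f lam x₀) t ≤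
        ENNReal.ofReal (c * γ ^ t) := by
    intro lam hlam t
    obtain ⟨h, q, hV, hZ⟩ := hφf.exists_isLyapunov_chain hcon hL ha hb hr hlam hx₀
    exact hV.betaCoeff_le hv₀.le hρ.le hρ1 hw hγ0.le x₀ hZ t
  refine ⟨fun lam hlam => ⟨c, hc0, -Real.log γ, neg_pos.2 (Real.log_neg hγ0 hγ1), fun t => ?_⟩,
    c, hc0, fun t => iSup₂_le fun lam hlam => key lam hlam t⟩
  have : Real.exp (- -Real.log γ * t) = γ ^ t := by
    rw [neg_neg, mul_comm, Real.exp_nat_mul, Real.exp_log hγ0]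
  rw [this]
  exact key lam hlam t
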